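/- Let $0<a<b$, let $N\ge 1$ be an integer, let $\alpha_1,\dots,\alpha_N>0$, and let $0\le l_1<l_2<\dots<l_N\le 1$ be such that $$f(x)=\frac{\sqrt{(b-x)(x-a)}}{x}\sum_{k=1}^N\frac{\alpha_k}{x^{l_k}}\,1_{(a,b)}(x)$$ is a probability density on $\mathbb{R}$. Let $X$ be a random variable with law $f(x)\,dx$ (so that $X\in(a,b)$ almost surely). Then for every real $r\le -1$, and also for every real $r\ge 1$, the law of $X^r$ belongs to the class UI. Here a probability measure $\mu$ on $\mathbb{R}$ belongs to UI (univalent inverse Cauchy transform) if the right inverse $G_\mu^{-1}$ of its Cauchy transform $G_\mu(z)=\int_{\mathbb{R}}\frac{1}{z-x}\,d\mu(x)$ has a univalent analytic continuation to the lower half plane $\mathbb{C}^-$; that is, there is an injective analytic function $g:\mathbb{C}^-\to\mathbb{C}$ such that for every $\gamma>0$ there are $\lambda,M,\delta>0$ for which $G_\mu$ is injective on $\Gamma_{\lambda,M}=\{z: \operatorname{Im} z>M,\ \lambda|\operatorname{Re} z|<\operatorname{Im} z\}$ and, for every $w\in\Lambda_{\gamma,\delta}=\{w: -\delta<\operatorname{Im}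 w<0,\ \gamma|\operatorname{Re} w|<-\operatorname{Im} w\}$, one has $g(w)\in\Gamma_{\lambda,M}$ and $G_\mu(g(w))=w$. -/

import Mathlib

open MeasureTheory ProbabilityTheory

noncomputable section

namespace FreeProb

/-- The complex lower half plane. -/
def lowerHalfPlane : Set ℂ := {z | z.im < 0}

/-- The Cauchy transform `G_μ(z) = ∫ 1 / (z - x) dμ(x)`; it is only used for `z` in the upper half
plane, where the integrand is bounded and continuous in `x`. -/
def cauchyTransform (μ : Measure ℝ) (z : ℂ) : ℂ := ∫ x : ℝ, 1 / (z - (x : ℂ)) ∂μ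

/-- The truncated cone in the upper half plane with parameters `lam, M > 0`. -/
def truncatedCone (lam M : ℝ) : Set ℂ := {z | 0 < z.im ∧ lam * |z.re| < z.im ∧ M < z.im}

/-- The triangular domain in the lower half plane, with vertex at `0`, with parameters
`γ, δ > 0`. -/
def triangularDomain (γ δ : ℝ) : Set ℂ := {z | z.im < 0 ∧ γ * |z.re| < -z.im ∧ -δ < z.im}

/-- `g` coincides, on triangular domains, with the right inverse `G_μ⁻¹` of the Cauchy transform:
for every `γ > 0` there are `lam, M, δ > 0` such that `G_μ` is injective on the truncated cone
with parameters `lam, M`, and `g` maps the triangular domain with parameters `γ, δ` into that cone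
with `G_μ (g w) = w` there (so the triangular domain lies in the image of the cone, and `g` is
on it the unique right inverse of `G_μ` with values in the cone). -/
def ExtendsInverseCauchy (μ : Measure ℝ) (g : ℂ → ℂ) : Prop :=
  ∀ γ : ℝ, 0 < γ → ∃ lam M δ : ℝ, 0 < lam ∧ 0 < M ∧ 0 < δ ∧
    Set.InjOn (cauchyTransform μ) (truncatedCone lam M) ∧
    ∀ w ∈ triangularDomain γ δ,
      g w ∈ truncatedCone lam M ∧ cauchyTransform μ (g w) = w

/-- The class UI (univalent inverse Cauchy transform): probability measures on `ℝ` for which the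
right inverse of the Cauchy transform, originally defined on a triangular domain, has a univalent
analytic continuation to the lower half plane. -/
def IsUI (μ : Measure ℝ) : Prop :=
  IsProbabilityMeasure μ ∧ ∃ g : ℂ → ℂ,
    DifferentiableOn ℂ g lowerHalfPlane ∧ Set.InjOn g lowerHalfPlane ∧
    ExtendsInverseCauchy μ g

/-- The density
`x ↦ (√((b - x)(x - a)) / x) * ∑ k, α k / x ^ l k` on `(a, b)`, extended by `0`. -/
def gpfpDensity (a b : ℝ) (N : ℕ) (α l : Fin N → ℝ) : ℝ → ℝ :=
  Set.indicator (Set.Ioo a b)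
    (fun x => Real.sqrt ((b - x) * (x - a)) / x * ∑ k, α k / x ^ l k)

/-- The measure with density `gpfpDensity` with respect to Lebesgue measure. -/
def gpfp (a b : ℝ) (N : ℕ) (α l : Fin N → ℝ) : Measure ℝ :=
  volume.withDensity (fun x => ENNReal.ofReal (gpfpDensity a b N α l x))

end FreeProb

end

namespace FreeProb

open Filter Topology Set Metric
open scoped Real

/-! The substitution `x = 1 / u` sends a density of the family to one on `(1/b, 1/a)` with exponents
`1 - l`, so negative `r` reduces to `r ≥ 1`; `PowerData` records the data for `r ≥ 1`.

Put `z = ζ ^ r` with `ζ` in the sector `|arg ζ| < π / r`. In `1 / (ζ ^ r - x ^ r)` the pole at `ζ =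
x` is split off with a factor `(ζ / x) ^ (-(l k + r))`, chosen so that the powers of `x` in the
density cancel. Hence `G (ζ ^ r) = R ζ + q ζ * S ζ`, where `R` and `q` are holomorphic on the whole
sector and `S` is the Cauchy transform of the semicircle factor (`R_eq`). In the Joukowski
coordinate `ζ = J v`, `S` equals `π ρ v` inside the unit disc (`S_J`), so the right-hand side
continues across the lower half of the unit circle, that is, across `(a, b)`. This is `Gt` on the
domain `V` in the lower half-plane.

`Gt` maps a part of `V` bijectively onto the lower half-plane. At each boundary point of `V`, and at
infinity, `Gt` has a limit with nonnegative imaginary part, except where `J v → 0` with `|v| > 1`,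
where it blows up (`boundary_behaviour`). The sign on the ray `arg ζ = -π / r` is where `0 ≤ l k ≤
1` is essential (`im_inv_sub_mul_exp_nonneg`). So `Gt` is proper over the lower half-plane
(`properOver_Gt`). Its degree is one: the value `-iT` with `T` large is taken only near the
singularity, where `Gt` behaves like `-C ζ ^ (-c)` with `c = max l + r ≤ 2 r`, and the available
angle admits exactly one solution (`exists_unique_noncritical_value`).

A proper map of degree one has a holomorphic inverse `h` (`ProperOver.exists_inverse`). The function
`w ↦ J (h w) ^ r` is then univalent, and it agrees with the inverse Cauchy transform near `0`. -/

/-! ### Holomorphic parameter integrals and critical points. -/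

theorem differentiableOn_intervalIntegral {U : Set ℂ} (hU : IsOpen U) {F : ℂ → ℝ → ℂ} {a b : ℝ}
    (hab : a ≤ b) (hc : ContinuousOn (Function.uncurry F) (U ×ˢ Icc a b))
    (hd : ∀ x ∈ Icc a b, DifferentiableOn ℂ (fun z => F z x) U) :
    DifferentiableOn ℂ (fun z => ∫ x in a..b, F z x) U := by
  intro z₀ hz₀
  obtain ⟨ε, hε, hball⟩ := Metric.isOpen_iff.1 hU z₀ hz₀
  have hsub : closedBall z₀ (2 * (ε / 3)) ⊆ U :=
    (closedBall_subset_ball (by linarith)).trans hball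
  set δ := ε / 3 with hδdef
  have hδ : 0 < δ := by positivity
  obtain ⟨M, hM⟩ := ((isCompact_closedBall z₀ (2 * δ)).prod
    (isCompact_Icc (a := a) (b := b))).exists_bound_of_continuousOn
      (hc.mono (prod_mono hsub Subset.rfl))
  have hcx : ∀ z ∈ U, ContinuousOn (F z) (Icc a b) := fun z hz =>
    hc.comp (f := fun x : ℝ => (z, x)) (by fun_prop) fun x hx => ⟨hz, hx⟩
  have hsubI : uIoc a b ⊆ Icc a b := by
    rw [uIoc_of_le hab]; exact Ioc_subset_Icc_self
  have hmeas : ∀ z ∈ U, AEStronglyMeasurable (F z) (volume.restrict (uIoc a b)) := fun z hz =>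
    ((hcx z hz).mono hsubI).aestronglyMeasurable measurableSet_uIoc
  -- Difference quotients along a sequence show that the derivative is measurable in `x`; its size
  -- is bounded below by Cauchy's estimate on discs of radius `δ`.
  have hlim : ∀ x ∈ uIoc a b, Tendsto (fun n : ℕ => ((δ / (n + 1) : ℝ) : ℂ)⁻¹ •
      (F (z₀ + ((δ / (n + 1) : ℝ) : ℂ)) x - F z₀ x)) atTop
      (𝓝 (deriv (fun z => F z x) z₀)) := by
    intro x hx
    have h1 := ((hd x (hsubI hx)).differentiableAt (hU.mem_nhds hz₀)).hasDerivAt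
    refine h1.tendsto_slope_zero.comp (tendsto_nhdsWithin_iff.2 ⟨?_, ?_⟩)
    · have : Tendsto (fun n : ℕ => δ / ((n : ℝ) + 1)) atTop (𝓝 0) := by
        simpa [div_eq_mul_inv] using
          (tendsto_one_div_add_atTop_nhds_zero_nat (𝕜 := ℝ)).const_mul δ
      have h2 := (Complex.continuous_ofReal.tendsto 0).comp this
      rwa [Complex.ofReal_zero] at h2
    · refine Eventually.of_forall fun n => ?_
      have : δ / ((n : ℝ) + 1) ≠ 0 := by positivity
      exact Complex.ofReal_ne_zero.2 this
  have hmem : ∀ n : ℕ, z₀ + ((δ / (n + 1) : ℝ) : ℂ) ∈ U := by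
    intro n
    apply hsub
    rw [mem_closedBall, dist_eq_norm, add_sub_cancel_left, Complex.norm_real,
      Real.norm_of_nonneg (by positivity)]
    have : δ / ((n : ℝ) + 1) ≤ δ := div_le_self hδ.le (by linarith [n.cast_nonneg (α := ℝ)])
    linarith
  have key := intervalIntegral.hasDerivAt_integral_of_dominated_loc_of_deriv_le
    (μ := volume) (a := a) (b := b) (F := F) (F' := fun z x => deriv (fun z => F z x) z)
    (x₀ := z₀) (s := ball z₀ δ) (bound := fun _ => M / δ) (ball_mem_nhds _ hδ)
    (Filter.mem_of_superset (hU.mem_nhds hz₀) fun z hz => hmeas z hz)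
    ((hcx z₀ hz₀).intervalIntegrable_of_Icc hab)
    (aestronglyMeasurable_of_tendsto_ae atTop
      (fun n : ℕ => (((hmeas _ (hmem n)).sub (hmeas z₀ hz₀)).const_smul
        (((δ / (n + 1) : ℝ) : ℂ)⁻¹)))
      ((ae_restrict_iff' measurableSet_uIoc).2 (Eventually.of_forall hlim)))
    (Eventually.of_forall fun x hx z hz => ?_) (by simp)
    (Eventually.of_forall fun x hx z hz => ?_)
  · exact key.2.differentiableAt.differentiableWithinAt
  · have hzsub : closedBall z δ ⊆ closedBall z₀ (2 * δ) :=
      closedBall_subset_closedBall' (by have := mem_ball.1 hz; linarith)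
    refine Complex.norm_deriv_le_of_forall_mem_sphere_norm_le hδ ?_ fun y hy =>
      hM (y, x) ⟨hzsub (sphere_subset_closedBall hy), hsubI hx⟩
    exact ((hd x (hsubI hx)).mono (hzsub.trans hsub)).diffContOnCl_ball Subset.rfl
  · exact ((hd x (hsubI hx)).differentiableAt
      (hU.mem_nhds (hsub (ball_subset_closedBall (ball_subset_ball (by linarith) hz))))).hasDerivAt

/-- Near a critical point, a nonconstant analytic function takes every nearby value at least
twice. -/
theorem eventually_exists_two_preimages {f : ℂ → ℂ} {z₀ : ℂ} (hf : AnalyticAt ℂ f z₀)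
    (hd : deriv f z₀ = 0) (hnc : ¬ ∀ᶠ z in 𝓝 z₀, f z = f z₀) {N : Set ℂ} (hN : N ∈ 𝓝 z₀) :
    ∀ᶠ w in 𝓝[≠] (f z₀), ∃ z₁ ∈ N, ∃ z₂ ∈ N, z₁ ≠ z₂ ∧ f z₁ = w ∧ f z₂ = w := by
  obtain ⟨n, g, hg, hg0, hfg⟩ :=
    (hf.sub analyticAt_const).exists_eventuallyEq_pow_smul_nonzero_iff (f := fun z => f z - f z₀)
      |>.2 (by simpa [sub_eq_zero] using hnc)
  have hn : 2 ≤ n := by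
    by_contra! h
    interval_cases n
    · have := hfg.self_of_nhds
      simp at this
      exact hg0 this.symm
    · have h1 : HasDerivAt (fun z => (z - z₀) ^ 1 • g z) (g z₀) z₀ := by
        have := ((hasDerivAt_id z₀).sub_const z₀).mul hg.differentiableAt.hasDerivAt
        simpa using! this
      have h2 : HasDerivAt (fun z => f z - f z₀) (g z₀) z₀ := h1.congr_of_eventuallyEq hfg
      have h3 := h2.deriv
      rw [deriv_sub_const, hd] at h3
      exact hg0 h3.symm
  have hn0 : n ≠ 0 := by omega
  set c : ℂ := g z₀
  -- A holomorphic `n`-th root of `f - f z₀`. Dividing `g` by `c = g z₀` keeps the argument of the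
  -- logarithm near `1`, away from the cut.
  set h : ℂ → ℂ := fun z => (z - z₀) * (c ^ ((n : ℂ)⁻¹) * Complex.exp (Complex.log (g z / c) / n))
    with hh
  have hgc : AnalyticAt ℂ (fun z => g z / c) z₀ := hg.div analyticAt_const hg0
  have hlog : AnalyticAt ℂ (fun z => Complex.log (g z / c)) z₀ := by
    refine AnalyticAt.clog hgc ?_
    simp [c, div_self hg0]
  have hroot : AnalyticAt ℂ
      (fun z => c ^ ((n : ℂ)⁻¹) * Complex.exp (Complex.log (g z / c) / n)) z₀ := by
    refine analyticAt_const.mul (AnalyticAt.cexp (hlog.div analyticAt_const ?_))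
    exact_mod_cast hn0
  have hhan : AnalyticAt ℂ h z₀ := (analyticAt_id.sub analyticAt_const).mul hroot
  have hh0 : h z₀ = 0 := by simp [hh]
  have hhd : deriv h z₀ ≠ 0 := by
    have h1 := ((hasDerivAt_id z₀).sub_const z₀).mul hroot.differentiableAt.hasDerivAt
    have h2 : deriv h z₀ = c ^ ((n : ℂ)⁻¹) * Complex.exp (Complex.log (g z₀ / c) / n) := by
      simpa using! h1.deriv
    rw [h2]
    refine mul_ne_zero ?_ (Complex.exp_ne_zero _)
    rw [Complex.cpow_def_of_ne_zero hg0]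
    exact Complex.exp_ne_zero _
  have hpow : ∀ᶠ z in 𝓝 z₀, f z = f z₀ + h z ^ n := by
    filter_upwards [hfg, hg.continuousAt.eventually_ne hg0] with z hz hgz
    have h1 : (c ^ ((n : ℂ)⁻¹)) ^ n = c := by
      rw [← Complex.cpow_nat_mul, mul_inv_cancel₀ (by exact_mod_cast hn0), Complex.cpow_one]
    have h2 : Complex.exp (Complex.log (g z / c) / n) ^ n = g z / c := by
      rw [← Complex.exp_nat_mul, mul_div_cancel₀ _ (by exact_mod_cast hn0),
        Complex.exp_log (div_ne_zero hgz hg0)]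
    rw [hh]
    simp only [mul_pow, h1, h2]
    rw [mul_div_cancel₀ _ hg0, ← smul_eq_mul, ← hz]
    ring
  set k := hhan.hasStrictDerivAt.localInverse _ _ _ hhd with hk
  have hkan : AnalyticAt ℂ k 0 := by simpa [hh0] using hhan.analyticAt_localInverse hhd
  have hk0 : k 0 = z₀ := by
    have : k (h z₀) = z₀ := HasStrictFDerivAt.localInverse_apply_image ..
    rwa [hh0] at this
  have hkr : ∀ᶠ t in 𝓝 (0 : ℂ), h (k t) = t := by
    simpa [hh0] using hhan.hasStrictDerivAt.eventually_right_inverse hhd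
  have hkt : Tendsto k (𝓝 0) (𝓝 z₀) := by
    simpa [hk0] using hkan.continuousAt.tendsto
  have hgood : ∀ᶠ t in 𝓝 (0 : ℂ), h (k t) = t ∧ k t ∈ N ∧ f (k t) = f z₀ + t ^ n := by
    filter_upwards [hkr, hkt hN, hkt.eventually hpow] with t h1 h2 h3
    exact ⟨h1, h2, by rw [h3, h1]⟩
  -- In the coordinate `h` the map is `t ↦ t ^ n`, so `t` and `t * ω` give two preimages of the same
  -- value.
  set ω : ℂ := Complex.exp (2 * π * Complex.I / n)
  have hω : IsPrimitiveRoot ω n := Complex.isPrimitiveRoot_exp n hn0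
  have hω1 : ω ≠ 1 := hω.ne_one (by omega)
  have hroot0 : Tendsto (fun w : ℂ => (w - f z₀) ^ ((n : ℂ)⁻¹)) (𝓝[≠] (f z₀)) (𝓝 0) := by
    rw [tendsto_zero_iff_norm_tendsto_zero]
    have h1 : Tendsto (fun w : ℂ => ‖w - f z₀‖ ^ ((n : ℝ)⁻¹)) (𝓝 (f z₀)) (𝓝 0) := by
      have : ContinuousAt (fun w : ℂ => ‖w - f z₀‖ ^ ((n : ℝ)⁻¹)) (f z₀) :=
        ContinuousAt.rpow_const (by fun_prop) (Or.inr (by positivity))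
      simpa [ContinuousAt, Real.zero_rpow (inv_ne_zero (Nat.cast_ne_zero.2 hn0))] using this
    refine (h1.mono_left nhdsWithin_le_nhds).congr' ?_
    filter_upwards [self_mem_nhdsWithin] with w hw
    have := Complex.norm_cpow_real (w - f z₀) ((n : ℝ)⁻¹)
    push_cast at this
    exact this.symm
  have hroot0' : Tendsto (fun w : ℂ => (w - f z₀) ^ ((n : ℂ)⁻¹) * ω) (𝓝[≠] (f z₀)) (𝓝 0) := by
    simpa using hroot0.mul_const ω
  filter_upwards [self_mem_nhdsWithin, hroot0.eventually hgood, hroot0'.eventually hgood]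
    with w hw h1 h2
  have hw' : w - f z₀ ≠ 0 := sub_ne_zero.2 hw
  set t := (w - f z₀) ^ ((n : ℂ)⁻¹)
  have ht : t ^ n = w - f z₀ := by
    rw [← Complex.cpow_nat_mul, mul_inv_cancel₀ (by exact_mod_cast hn0), Complex.cpow_one]
  have ht0 : t ≠ 0 := fun h => hw' (by rw [← ht, h, zero_pow hn0])
  refine ⟨k t, h1.2.1, k (t * ω), h2.2.1, fun he => ?_, ?_, ?_⟩
  · have : t = t * ω :=
      calc t = h (k t) := h1.1.symm
        _ = t * ω := by rw [he, h2.1]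
    exact hω1 (mul_left_cancel₀ ht0 (by rw [← this, mul_one]))
  · rw [h1.2.2, ht]; ring
  · rw [h2.2.2, mul_pow, ht, hω.pow_eq_one]; ring

/-! ### Proper holomorphic maps and degree one. -/

section Proper

variable {V Ω : Set ℂ} {F : ℂ → ℂ}

/-- Properness of `F` from `V` over `Ω`, in terms of ultrafilters. -/
def ProperOver (F : ℂ → ℂ) (V Ω : Set ℂ) : Prop :=
  ∀ u : Ultrafilter ℂ, V ∈ u → ∀ w ∈ Ω, Tendsto F u (𝓝 w) → ∃ v ∈ V, (u : Filter ℂ) ≤ 𝓝 v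

/-- The points near which `F` is identically `F v` form an open set, compact by properness. A
nonempty compact open subset of `ℂ` does not exist. -/
theorem ProperOver.not_eventually_const (hV : IsOpen V) (hF : DifferentiableOn ℂ F V)
    (hp : ProperOver F V Ω) {v : ℂ} (hv : v ∈ V) (hw : F v ∈ Ω) :
    ¬ ∀ᶠ z in 𝓝 v, F z = F v := by
  intro hcst
  set C : Set ℂ := {z ∈ V | ∀ᶠ y in 𝓝 z, F y = F v} with hC
  have hCo : IsOpen C := by
    rw [isOpen_iff_mem_nhds]
    rintro z ⟨hz, hz'⟩
    filter_upwards [hV.mem_nhds hz, hz'.eventually_nhds] with y h1 h2 using ⟨h1, h2⟩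
  have hCc : IsCompact C := by
    rw [isCompact_iff_ultrafilter_le_nhds']
    intro u hu
    have hVu : V ∈ u := mem_of_superset hu fun z hz => hz.1
    have ht : Tendsto F u (𝓝 (F v)) := by
      refine tendsto_const_nhds.congr' ?_
      filter_upwards [hu] with z hz using hz.2.self_of_nhds.symm
    obtain ⟨z, hz, huz⟩ := hp u hVu _ hw ht
    refine ⟨z, ⟨hz, ?_⟩, huz⟩
    have han : AnalyticAt ℂ F z := hF.analyticAt (hV.mem_nhds hz)
    rcases han.eventually_eq_or_eventually_ne (analyticAt_const (v := F v)) with h | h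
    · exact h
    -- If `F` avoids the value `F v` near `z` except possibly at `z`, the ultrafilter must be
    -- concentrated at `z`, which puts `z` in `C`.
    · exfalso
      rw [eventually_nhdsWithin_iff] at h
      have hCz : ∀ᶠ y in (u : Filter ℂ), y = z := by
        filter_upwards [huz h, hu] with y h1 h2
        by_contra hne
        exact h1 hne h2.2.self_of_nhds
      have hzC : z ∈ C := by
        obtain ⟨y, hy, hy'⟩ := ((hCz.and hu).exists)
        exact hy ▸ hy'
      exact (h.filter_mono nhdsWithin_le_nhds |>.and
        (hzC.2.filter_mono (nhdsWithin_le_nhds (s := {z}ᶜ))) |>.and self_mem_nhdsWithin).exists.elim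
        fun y hy => hy.1.1 hy.2 hy.1.2
  have hcl : IsClopen C := ⟨hCc.isClosed, hCo⟩
  rcases isClopen_iff.1 hcl with h | h
  · exact (h ▸ (⟨hv, hcst⟩ : v ∈ C) : v ∈ (∅ : Set ℂ))
  · exact noncompact_univ ℂ (h ▸ hCc)

theorem ProperOver.exists_limit (hV : IsOpen V) (hF : DifferentiableOn ℂ F V)
    (hp : ProperOver F V Ω) {w : ℂ} (hw : w ∈ Ω) {u : Ultrafilter ℂ} (hu : (u : Filter ℂ) ≤ 𝓝 w)
    {s : ℂ → ℂ} (hs : ∀ᶠ y in (u : Filter ℂ), s y ∈ V ∧ F (s y) = y) :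
    ∃ v ∈ V, F v = w ∧ Tendsto s u (𝓝 v) := by
  have ht : Tendsto F (u.map s) (𝓝 w) := by
    rw [Ultrafilter.coe_map, tendsto_map'_iff]
    exact (tendsto_id'.2 hu).congr' (hs.mono fun y hy => hy.2.symm)
  obtain ⟨v, hv, huv⟩ := hp (u.map s) (hs.mono fun y hy => hy.1) w hw ht
  refine ⟨v, hv, ?_, huv⟩
  exact tendsto_nhds_unique
    ((hF.continuousOn.continuousAt (hV.mem_nhds hv)).tendsto.mono_left huv) ht

/-- The set of attained values is open by the open mapping theorem and relatively closed by
properness. -/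
theorem ProperOver.surjOn (hV : IsOpen V) (hF : DifferentiableOn ℂ F V)
    (hp : ProperOver F V Ω) (hΩ : IsOpen Ω) (hΩc : IsPreconnected Ω)
    (hne : ∃ v ∈ V, F v ∈ Ω) : ∀ w ∈ Ω, ∃ v ∈ V, F v = w := by
  set S : Set ℂ := {w ∈ Ω | ∃ v ∈ V, F v = w}
  have hSo : IsOpen S := by
    rw [isOpen_iff_mem_nhds]
    rintro _ ⟨hw, v, hv, rfl⟩
    have han : AnalyticAt ℂ F v := hF.analyticAt (hV.mem_nhds hv)
    have h := han.eventually_constant_or_nhds_le_map_nhds.resolve_left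
      (hp.not_eventually_const hV hF hv hw)
    filter_upwards [hΩ.mem_nhds hw, h (image_mem_map (hV.mem_nhds hv))] with y h1 h2
    obtain ⟨z, hz, rfl⟩ := h2
    exact ⟨h1, z, hz, rfl⟩
  have hsub : Ω ⊆ S := by
    refine hΩc.subset_of_closure_inter_subset hSo ?_ ?_
    · obtain ⟨v, hv, hw⟩ := hne
      exact ⟨F v, hw, hw, v, hv, rfl⟩
    · rintro w ⟨hw, hwΩ⟩
      obtain ⟨u, hu, huw⟩ := mem_closure_iff_ultrafilter.1 hw
      have : ∀ y, ∃ v, y ∈ S → v ∈ V ∧ F v = y := by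
        intro y
        by_cases hy : y ∈ S
        · obtain ⟨v, hv⟩ := hy.2; exact ⟨v, fun _ => hv⟩
        · exact ⟨0, fun h => absurd h hy⟩
      choose s hs using this
      obtain ⟨v, hv, hvw, -⟩ := hp.exists_limit hV hF hwΩ huw
        (Filter.mem_of_superset hu fun y hy => hs y hy)
      exact ⟨hwΩ, v, hv, hvw⟩
  exact fun w hw => (hsub hw).2

/-- The values taken twice, or at a critical point, form an open and relatively closed subset of
`Ω`. By connectedness one value outside this set makes it empty; this replaces a count of the
degree. -/
theorem ProperOver.unique (hV : IsOpen V) (hF : DifferentiableOn ℂ F V)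
    (hp : ProperOver F V Ω) (hΩ : IsOpen Ω) (hΩc : IsPreconnected Ω)
    (hu : ∃ w ∈ Ω, ∀ v ∈ V, F v = w → deriv F v ≠ 0 ∧ ∀ v' ∈ V, F v' = w → v = v') :
    ∀ v ∈ V, F v ∈ Ω → deriv F v ≠ 0 ∧ ∀ v' ∈ V, F v' = F v → v = v' := by
  set T : Set ℂ := {w ∈ Ω | ∃ v ∈ V, ∃ v' ∈ V, F v = w ∧ F v' = w ∧ (v ≠ v' ∨ deriv F v = 0)}
    with hT
  have hopen : ∀ v ∈ V, F v ∈ Ω → ∀ N ∈ 𝓝 v, ∀ᶠ y in 𝓝 (F v), ∃ z ∈ N, F z = y := by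
    intro v hv hw N hN
    have han : AnalyticAt ℂ F v := hF.analyticAt (hV.mem_nhds hv)
    have h := han.eventually_constant_or_nhds_le_map_nhds.resolve_left
      (hp.not_eventually_const hV hF hv hw)
    exact h (image_mem_map hN)
  have hTo : IsOpen T := by
    rw [isOpen_iff_mem_nhds]
    rintro w ⟨hw, v, hv, v', hv', hvw, hvw', h⟩
    by_cases hne : v = v'
    · have hd : deriv F v = 0 := h.resolve_left (not_not.2 hne)
      have han : AnalyticAt ℂ F v := hF.analyticAt (hV.mem_nhds hv)
      have h2 := eventually_exists_two_preimages han hd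
        (hp.not_eventually_const hV hF hv (hvw ▸ hw)) (hV.mem_nhds hv)
      rw [hvw, eventually_nhdsWithin_iff] at h2
      filter_upwards [hΩ.mem_nhds hw, h2] with y hy h3
      by_cases hyw : y = w
      · exact ⟨hy, v, hv, v, hv, by rw [hvw, hyw], by rw [hvw, hyw], Or.inr hd⟩
      · obtain ⟨z₁, hz₁, z₂, hz₂, h12, e1, e2⟩ := h3 hyw
        exact ⟨hy, z₁, hz₁, z₂, hz₂, e1, e2, Or.inl h12⟩
    · obtain ⟨A, B, hA, hB, hvA, hvB, hAB⟩ := t2_separation hne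
      have h1 := hopen v hv (hvw ▸ hw) _ (inter_mem (hV.mem_nhds hv) (hA.mem_nhds hvA))
      have h2 := hopen v' hv' (hvw' ▸ hw) _ (inter_mem (hV.mem_nhds hv') (hB.mem_nhds hvB))
      rw [hvw] at h1
      rw [hvw'] at h2
      filter_upwards [hΩ.mem_nhds hw, h1, h2] with y hy ⟨z, hz, hzy⟩ ⟨z', hz', hzy'⟩
      refine ⟨hy, z, hz.1, z', hz'.1, hzy, hzy', Or.inl fun e => ?_⟩
      exact disjoint_left.1 hAB hz.2 (e ▸ hz'.2)
  have hTc : closure T ∩ Ω ⊆ T := by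
    rintro w ⟨hw, hwΩ⟩
    obtain ⟨u, hu, huw⟩ := mem_closure_iff_ultrafilter.1 hw
    have : ∀ y, ∃ v v', y ∈ T → v ∈ V ∧ v' ∈ V ∧ F v = y ∧ F v' = y ∧
        (v ≠ v' ∨ deriv F v = 0) := by
      intro y
      by_cases hy : y ∈ T
      · obtain ⟨v, hv, v', hv', h⟩ := hy.2
        exact ⟨v, v', fun _ => ⟨hv, hv', h⟩⟩
      · exact ⟨0, 0, fun h => absurd h hy⟩
    choose s s' hs using this
    obtain ⟨v, hv, hvw, hsv⟩ := hp.exists_limit hV hF hwΩ huw (s := s)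
      (Filter.mem_of_superset hu fun y hy => ⟨(hs y hy).1, (hs y hy).2.2.1⟩)
    obtain ⟨v', hv', hvw', hsv'⟩ := hp.exists_limit hV hF hwΩ huw (s := s')
      (Filter.mem_of_superset hu fun y hy => ⟨(hs y hy).2.1, (hs y hy).2.2.2.1⟩)
    refine ⟨hwΩ, v, hv, v', hv', hvw, hvw', ?_⟩
    -- Two families of preimages merging at a noncritical point contradict local injectivity there,
    -- and critical points cannot accumulate at it.
    by_contra! hcon
    obtain ⟨rfl, hd⟩ := hcon
    have han : AnalyticAt ℂ F v := hF.analyticAt (hV.mem_nhds hv)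
    have hinj := han.hasStrictDerivAt.eventually_left_inverse hd
    have hd' := han.deriv.continuousAt.eventually_ne hd
    obtain ⟨y, hyT, h1, h2, h3⟩ := (Eventually.and hu ((hsv.eventually hinj).and
      ((hsv'.eventually hinj).and (hsv.eventually hd')))).exists
    have h4 := hs y hyT
    rcases h4.2.2.2.2 with h5 | h5
    · apply h5
      rw [← h1, ← h2, h4.2.2.1, h4.2.2.2.1]
    · exact h3 h5
  intro v hv hw
  by_contra hcon
  have hvT : F v ∈ T := by
    refine ⟨hw, v, hv, ?_⟩
    by_cases hd : deriv F v = 0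
    · exact ⟨v, hv, rfl, rfl, Or.inr hd⟩
    · have : ∃ v' ∈ V, F v' = F v ∧ v ≠ v' := by
        by_contra! h
        exact hcon ⟨hd, h⟩
      obtain ⟨v', h1, h2, h3⟩ := this
      exact ⟨v', h1, rfl, h2, Or.inl h3⟩
  have hsub : Ω ⊆ T := hΩc.subset_of_closure_inter_subset hTo ⟨F v, hw, hvT⟩ hTc
  obtain ⟨w, hwΩ, hw'⟩ := hu
  obtain ⟨-, z, hz, z', hz', e, e', h⟩ := hsub hwΩ
  rcases h with h | h
  · exact h ((hw' z hz e).2 z' hz' e')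
  · exact (hw' z hz e).1 h

/-- A proper map of degree one has an analytic inverse. -/
theorem ProperOver.exists_inverse (hV : IsOpen V) (hF : DifferentiableOn ℂ F V)
    (hp : ProperOver F V Ω) (hΩ : IsOpen Ω) (hΩc : IsPreconnected Ω)
    (hne : ∃ v ∈ V, F v ∈ Ω)
    (hu : ∃ w ∈ Ω, ∀ v ∈ V, F v = w → deriv F v ≠ 0 ∧ ∀ v' ∈ V, F v' = w → v = v') :
    ∃ h : ℂ → ℂ, DifferentiableOn ℂ h Ω ∧
      ∀ w ∈ Ω, h w ∈ V ∧ F (h w) = w ∧ ∀ v ∈ V, F v = w → v = h w := by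
  have hsurj := hp.surjOn hV hF hΩ hΩc hne
  have huniq := hp.unique hV hF hΩ hΩc hu
  have : ∀ w, ∃ v, w ∈ Ω → v ∈ V ∧ F v = w := by
    intro w
    by_cases hw : w ∈ Ω
    · obtain ⟨v, hv⟩ := hsurj w hw; exact ⟨v, fun _ => hv⟩
    · exact ⟨0, fun h => absurd h hw⟩
  choose h hh using this
  have hun : ∀ w ∈ Ω, ∀ v ∈ V, F v = w → v = h w := by
    intro w hw v hv e
    exact ((huniq (h w) (hh w hw).1 ((hh w hw).2.symm ▸ hw)).2 v hv
      (by rw [e, (hh w hw).2])).symm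
  refine ⟨h, fun w hw => ?_, fun w hw => ⟨(hh w hw).1, (hh w hw).2, hun w hw⟩⟩
  have hv := (hh w hw).1
  have e := (hh w hw).2
  have han : AnalyticAt ℂ F (h w) := hF.analyticAt (hV.mem_nhds hv)
  have hd := (huniq (h w) hv (e.symm ▸ hw)).1
  set k := han.hasStrictDerivAt.localInverse _ _ _ hd
  have hkan : AnalyticAt ℂ k w := by
    have := han.analyticAt_localInverse hd
    rwa [e] at this
  have hkr : ∀ᶠ t in 𝓝 w, F (k t) = t := by
    have := han.hasStrictDerivAt.eventually_right_inverse hd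
    rwa [e] at this
  have hk0 : k w = h w := by
    have : k (F (h w)) = h w := HasStrictFDerivAt.localInverse_apply_image ..
    rwa [e] at this
  have hkV : ∀ᶠ t in 𝓝 w, k t ∈ V :=
    hkan.continuousAt.eventually (by rw [hk0]; exact hV.mem_nhds hv)
  have heq : h =ᶠ[𝓝 w] k := by
    filter_upwards [hΩ.mem_nhds hw, hkr, hkV] with t h1 h2 h3
    exact (hun t h1 (k t) h3 h2).symm
  exact (hkan.differentiableAt.congr_of_eventuallyEq heq).differentiableWithinAt

end Proper

/-! ### Half-planes and the Cauchy transform of the semicircle law. -/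

theorem isPreconnected_lowerHalfPlane : IsPreconnected lowerHalfPlane :=
  (convex_halfSpace_im_lt 0).isPreconnected

theorem isOpen_lowerHalfPlane : IsOpen lowerHalfPlane :=
  isOpen_lt Complex.continuous_im continuous_const

/-- A holomorphic function on a right half plane with a limit as `re z → ∞` has derivative
tending to `0`. -/
theorem exists_norm_deriv_le_of_tendsto_re {f : ℂ → ℂ} {c : ℂ} {X : ℝ}
    (hf : DifferentiableOn ℂ f {z | X < z.re}) (hl : Tendsto f (comap Complex.re atTop) (𝓝 c))
    {ε : ℝ} (hε : 0 < ε) : ∃ Y, X ≤ Y ∧ ∀ z : ℂ, Y < z.re → ‖f z - c‖ ≤ ε ∧ ‖deriv f z‖ ≤ ε := by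
  have h1 : ∀ᶠ z in comap Complex.re atTop, ‖f z - c‖ ≤ ε := by
    filter_upwards [hl (closedBall_mem_nhds c hε)] with z hz
    simpa [dist_eq_norm] using hz
  rw [eventually_comap] at h1
  obtain ⟨Y₀, hY₀⟩ := eventually_atTop.1 h1
  refine ⟨max X Y₀ + 1, by linarith [le_max_left X Y₀], fun z hz => ⟨?_, ?_⟩⟩
  · exact hY₀ z.re (by linarith [le_max_right X Y₀]) z rfl
  · have hsub : ∀ y ∈ closedBall z 1, max X Y₀ < y.re := by
      intro y hy
      have h2 := (Complex.abs_re_le_norm (y - z)).trans (by simpa [dist_eq_norm] using hy)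
      rw [Complex.sub_re] at h2
      linarith [(abs_le.1 h2).1]
    have h3 := Complex.norm_deriv_le_of_forall_mem_sphere_norm_le (c := z) (R := 1) (C := ε)
      (f := fun y => f y - c) one_pos ?_ fun y hy => ?_
    · simpa using h3
    · refine DifferentiableOn.diffContOnCl_ball (U := {z | X < z.re}) (hf.sub_const c) ?_
      exact fun y hy => (le_max_left _ _).trans_lt (hsub y hy)
    · exact hY₀ y.re ((le_max_right _ _).trans (hsub y (sphere_subset_closedBall hy)).le) y rfl

/-- With `u = exp (iθ)` this is a circle integral of `(u ^ 2 - 1) / (1 + v u)` against `u ^ (-2)`,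
so Cauchy's formula gives the derivative at `0`, which is `v`. -/
theorem integral_sin_div_one_add_mul_exp {v : ℂ} (hv : ‖v‖ < 1) :
    ∫ θ in (0 : ℝ)..2 * π, (Real.sin θ : ℂ) / (1 + v * Complex.exp (θ * Complex.I)) =
      -(π * Complex.I * v) := by
  set R : ℝ := 2 / (1 + ‖v‖) with hR
  have hv0 := norm_nonneg v
  -- `R` lies strictly between `1` and `1 / ‖v‖` (when `v ≠ 0`), so the pole `-1 / v` stays outside
  -- the ball.
  have hR1 : 1 < R := by rw [hR, lt_div_iff₀ (by linarith)]; linarith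
  have hne : ∀ u ∈ ball (0 : ℂ) R, 1 + v * u ≠ 0 := by
    intro u hu h
    have h1 : v * u = -1 := by linear_combination h
    have h2 : ‖v‖ * ‖u‖ = 1 := by rw [← norm_mul, h1]; simp
    have h3 : ‖u‖ < R := by simpa using hu
    have h4 : ‖v‖ * ‖u‖ ≤ ‖v‖ * R := mul_le_mul_of_nonneg_left h3.le hv0
    have h5 : ‖v‖ * R < 1 := by
      rw [hR, mul_div_assoc', div_lt_one (by linarith)]; linarith
    linarith
  have hd : DifferentiableOn ℂ (fun u : ℂ => (u ^ 2 - 1) / (1 + v * u)) (ball 0 R) := by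
    refine DifferentiableOn.div (by fun_prop) (by fun_prop) hne
  have h := Complex.two_pi_I_inv_smul_circleIntegral_sub_sq_inv_smul_of_differentiable
    isOpen_ball (closedBall_subset_ball hR1) hd (mem_ball_self one_pos)
  have hder : deriv (fun u : ℂ => (u ^ 2 - 1) / (1 + v * u)) 0 = v := by
    have h1 : HasDerivAt (fun u : ℂ => u ^ 2 - 1) (2 * 0) 0 := by
      simpa using! ((hasDerivAt_id (0 : ℂ)).pow 2).sub_const 1
    have h2 : HasDerivAt (fun u : ℂ => 1 + v * u) v 0 := by
      simpa using ((hasDerivAt_id (0 : ℂ)).const_mul v).const_add 1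
    have := (h1.div h2 (by simp)).deriv
    simpa using! this
  rw [hder, inv_smul_eq_iff₀ (by simp [Real.pi_ne_zero]), circleIntegral] at h
  have h2 : ∀ θ : ℝ, deriv (circleMap 0 1) θ • ((circleMap 0 1 θ - 0) ^ 2)⁻¹ •
      ((circleMap 0 1 θ ^ 2 - 1) / (1 + v * circleMap 0 1 θ)) =
      (-2) * ((Real.sin θ : ℂ) / (1 + v * Complex.exp (θ * Complex.I))) := by
    intro θ
    have hs : (Real.sin θ : ℂ) = (Complex.exp (-θ * Complex.I) - Complex.exp (θ * Complex.I))
        * Complex.I / 2 := by rw [Complex.ofReal_sin, Complex.sin]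
    have he : Complex.exp (-θ * Complex.I) = (Complex.exp (θ * Complex.I))⁻¹ := by
      rw [← Complex.exp_neg]; ring_nf
    have h0 := Complex.exp_ne_zero (θ * Complex.I)
    simp only [deriv_circleMap, circleMap, Complex.ofReal_one, one_mul, zero_add, smul_eq_mul,
      sub_zero]
    rw [hs, he]
    set u := Complex.exp (θ * Complex.I)
    field_simp
    ring
  simp_rw [h2] at h
  rw [intervalIntegral.integral_const_mul, smul_eq_mul] at h
  linear_combination (-1 / 2 : ℂ) * h

/-- Folding the previous integral by `θ ↦ -θ` pairs the factors `1 + v exp (±iθ)`, whose product is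
the denominator here. -/
theorem integral_sin_sq_div {v : ℂ} (hv : ‖v‖ < 1) (hv0 : v ≠ 0) :
    ∫ θ in (0 : ℝ)..π, (Real.sin θ : ℂ) ^ 2 / (1 + v ^ 2 + 2 * v * Real.cos θ) = (π : ℂ) / 2 := by
  set h : ℝ → ℂ := fun θ => (Real.sin θ : ℂ) / (1 + v * Complex.exp (θ * Complex.I)) with hh
  have hne : ∀ θ : ℝ, 1 + v * Complex.exp (θ * Complex.I) ≠ 0 := by
    intro θ h
    have h1 : v * Complex.exp (θ * Complex.I) = -1 := by linear_combination h
    have h2 : ‖v‖ = 1 := by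
      have := congrArg norm h1
      rwa [norm_mul, Complex.norm_exp_ofReal_mul_I, mul_one, norm_neg, norm_one] at this
    linarith
  have hcont : Continuous h := by
    refine Continuous.div (by fun_prop) (by fun_prop) hne
  have hper : Function.Periodic h (2 * π) := by
    intro θ
    simp only [hh, Real.sin_add_two_pi]
    congr 3
    push_cast
    rw [add_mul, Complex.exp_periodic]
  have h1 : ∫ θ in (0 : ℝ)..2 * π, h θ = ∫ θ in (-π)..π, h θ := by
    have := hper.intervalIntegral_add_eq 0 (-π)
    simpa [show -π + 2 * π = π by ring] using this
  have h2 : ∫ θ in (-π)..π, h θ = ∫ θ in (0 : ℝ)..π, (h θ + h (-θ)) := by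
    rw [intervalIntegral.integral_add (f := h) (g := fun θ => h (-θ))
      (hcont.intervalIntegrable _ _)
      ((hcont.comp continuous_neg).intervalIntegrable _ _),
      intervalIntegral.integral_comp_neg, neg_zero, add_comm]
    exact (intervalIntegral.integral_add_adjacent_intervals (hcont.intervalIntegrable _ _)
      (hcont.intervalIntegrable _ _)).symm
  have h3 : ∀ θ : ℝ, h θ + h (-θ) = (-2 * Complex.I * v) *
      ((Real.sin θ : ℂ) ^ 2 / (1 + v ^ 2 + 2 * v * Real.cos θ)) := by
    intro θ
    have e1 := hne θ
    have e2 := hne (-θ)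
    have hs : (Real.sin θ : ℂ) = (Complex.exp (-θ * Complex.I) - Complex.exp (θ * Complex.I))
        * Complex.I / 2 := by rw [Complex.ofReal_sin, Complex.sin]
    have hc : (Real.cos θ : ℂ) = (Complex.exp (θ * Complex.I) + Complex.exp (-θ * Complex.I))
        / 2 := by rw [Complex.ofReal_cos, Complex.cos]
    have he : Complex.exp (θ * Complex.I) * Complex.exp (-θ * Complex.I) = 1 := by
      rw [← Complex.exp_add]; simp
    simp only [hh, Real.sin_neg, Complex.ofReal_neg] at e1 e2 ⊢
    set A := Complex.exp (θ * Complex.I)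
    set B := Complex.exp (-θ * Complex.I)
    have hden : 1 + v ^ 2 + 2 * v * Real.cos θ = (1 + v * A) * (1 + v * B) := by
      rw [hc]; linear_combination (- v ^ 2) * he
    rw [hden, div_add_div _ _ e1 e2, ← mul_div_assoc]
    congr 1
    rw [hs]
    linear_combination ((B - A) ^ 2 * v * Complex.I / 2) * Complex.I_sq
  have h4 := integral_sin_div_one_add_mul_exp hv
  rw [show (∫ θ in (0 : ℝ)..2 * π, (Real.sin θ : ℂ) / (1 + v * Complex.exp (θ * Complex.I))) =
    ∫ θ in (0 : ℝ)..2 * π, h θ from rfl, h1, h2] at h4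
  simp_rw [h3] at h4
  rw [intervalIntegral.integral_const_mul] at h4
  have h5 : (-2 * Complex.I * v) ≠ 0 := by simp [hv0]
  apply mul_left_cancel₀ h5
  rw [h4]; ring

/-- The Joukowski map sending the unit circle onto `[a, b]`. -/
noncomputable def joukowski (a b : ℝ) (v : ℂ) : ℂ :=
  ((a + b) / 2 : ℝ) + ((b - a) / 2 : ℝ) * ((v + v⁻¹) / 2)

/-- The Cauchy transform of the semicircle law on `[a, b]`. -/
theorem integral_sqrt_div_joukowski_sub {a b : ℝ} (hab : a < b) {v : ℂ} (hv : ‖v‖ < 1)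
    (hv0 : v ≠ 0) :
    ∫ x in a..b, ((√((b - x) * (x - a)) : ℝ) : ℂ) / (joukowski a b v - x) =
      π * ((b - a) / 2 : ℝ) * v := by
  set m := (a + b) / 2 with hm
  set ρ := (b - a) / 2 with hρ
  have hρ0 : 0 < ρ := by rw [hρ]; linarith
  -- The minus sign makes `f` run from `a` to `b` as `θ` goes from `0` to `π`.
  set f : ℝ → ℝ := fun θ => m - ρ * Real.cos θ with hf
  set g : ℝ → ℂ := fun x => ((√((b - x) * (x - a)) : ℝ) : ℂ) / (joukowski a b v - x) with hg
  have hden : ∀ θ : ℝ, joukowski a b v - f θ = ρ / (2 * v) * (1 + v ^ 2 + 2 * v * Real.cos θ) := by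
    intro θ
    simp only [joukowski, hf, ← hm, ← hρ]
    push_cast
    field_simp
    ring
  have hne : ∀ θ : ℝ, 1 + v ^ 2 + 2 * v * Real.cos θ ≠ 0 := by
    intro θ h
    have hc : (Real.cos θ : ℂ) = (Complex.exp (θ * Complex.I) + Complex.exp (-θ * Complex.I))
        / 2 := by rw [Complex.ofReal_cos, Complex.cos]
    have he : Complex.exp (θ * Complex.I) * Complex.exp (-θ * Complex.I) = 1 := by
      rw [← Complex.exp_add]; simp
    have h1 : (1 + v * Complex.exp (θ * Complex.I)) * (1 + v * Complex.exp (-θ * Complex.I)) =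
        0 := by
      rw [← h, hc]; linear_combination v ^ 2 * he
    have key : ∀ t : ℝ, 1 + v * Complex.exp (t * Complex.I) ≠ 0 := by
      intro t h
      have h1 : v * Complex.exp (t * Complex.I) = -1 := by linear_combination h
      have h2 : ‖v‖ = 1 := by
        have := congrArg norm h1
        rwa [norm_mul, Complex.norm_exp_ofReal_mul_I, mul_one, norm_neg, norm_one] at this
      linarith
    rcases mul_eq_zero.1 h1 with h2 | h2
    · exact key _ h2
    · exact key (-θ) (by simpa using h2)
  have hmem : ∀ x ∈ Icc a b, joukowski a b v - x ≠ 0 := by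
    intro x hx
    set c := (m - x) / ρ with hcdef
    have hc : f (Real.arccos c) = x := by
      simp only [hf]
      rw [Real.cos_arccos]
      · rw [hcdef]; field_simp; ring
      · rw [hcdef, le_div_iff₀ hρ0, hm, hρ]; linarith [hx.2]
      · rw [hcdef, div_le_iff₀ hρ0, hm, hρ]; linarith [hx.1]
    rw [← hc, hden]
    refine mul_ne_zero (div_ne_zero (by exact_mod_cast hρ0.ne') (by simp [hv0])) (hne _)
  have hgc : ContinuousOn g (Icc a b) := by
    refine ContinuousOn.div (by fun_prop) (by fun_prop) hmem
  have hf0 : f 0 = a := by simp only [hf, Real.cos_zero, hm, hρ]; ring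
  have hfπ : f π = b := by simp only [hf, Real.cos_pi, hm, hρ]; ring
  have hsub : f '' uIcc 0 π ⊆ Icc a b := by
    rintro _ ⟨θ, -, rfl⟩
    have h1 := Real.neg_one_le_cos θ
    have h2 := Real.cos_le_one θ
    constructor <;> simp only [hf] <;> nlinarith [hm, hρ]
  have key := intervalIntegral.integral_deriv_smul_comp' (a := 0) (b := π) (f := f)
    (f' := fun θ => ρ * Real.sin θ) (g := g) (fun θ _ => by
      simpa using! ((Real.hasDerivAt_cos θ).const_mul ρ).const_sub m) (by fun_prop)
    (hgc.mono hsub)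
  rw [hf0, hfπ] at key
  rw [← key]
  have h2 : ∀ θ ∈ uIcc 0 π, (ρ * Real.sin θ) • (g ∘ f) θ = (2 * ρ * v : ℂ) *
      ((Real.sin θ : ℂ) ^ 2 / (1 + v ^ 2 + 2 * v * Real.cos θ)) := by
    intro θ hθ
    rw [uIcc_of_le Real.pi_pos.le] at hθ
    have hs : √((b - f θ) * (f θ - a)) = ρ * Real.sin θ := by
      rw [show (b - f θ) * (f θ - a) = (ρ * Real.sin θ) ^ 2 by
        rw [mul_pow, Real.sin_sq]; simp only [hf, hm, hρ]; ring]
      exact Real.sqrt_sq (mul_nonneg hρ0.le (Real.sin_nonneg_of_mem_Icc hθ))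
    simp only [Function.comp, hg]
    rw [hs, hden, Complex.real_smul]
    have := hne θ
    have hρ' : (ρ : ℂ) ≠ 0 := by exact_mod_cast hρ0.ne'
    push_cast at *
    field_simp
  rw [intervalIntegral.integral_congr h2, intervalIntegral.integral_const_mul,
    integral_sin_sq_div hv hv0]
  ring

/-! ### The splitting of the kernel on the sector. -/

/-- The data of the density `√((b - x) (x - a)) ∑ k, α k * x ^ (-1 - l k)` on `(a, b)`, and of an
exponent `r ≥ 1`. -/
structure PowerData (N : ℕ) where
  /-- left endpoint -/
  a : ℝ
  /-- right endpoint -/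
  b : ℝ
  /-- exponent of the random variable -/
  r : ℝ
  /-- coefficients -/
  α : Fin N → ℝ
  /-- exponents of the density -/
  l : Fin N → ℝ
  ha : 0 < a
  hab : a < b
  hr : 1 ≤ r
  hα : ∀ k, 0 < α k
  hl : Function.Injective l
  hl0 : ∀ k, 0 ≤ l k
  hl1 : ∀ k, l k ≤ 1
  mass : ∫ x in a..b, √((b - x) * (x - a)) * ∑ k, α k * x ^ (-1 - l k) = 1

theorem cpow_ofReal_mul {x : ℝ} (hx : 0 < x) {z : ℂ} (hz : z ≠ 0) (c : ℂ) :
    ((x : ℂ) * z) ^ c = (x : ℂ) ^ c * z ^ c := by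
  have hx' : (x : ℂ) ≠ 0 := by exact_mod_cast hx.ne'
  rw [Complex.cpow_def_of_ne_zero (mul_ne_zero hx' hz), Complex.cpow_def_of_ne_zero hx',
    Complex.cpow_def_of_ne_zero hz, Complex.log_ofReal_mul hx hz, ← Complex.exp_add,
    Complex.ofReal_log hx.le]
  ring_nf

namespace PowerData

variable {N : ℕ} (D : PowerData N)

/-- The semicircle factor of the density. -/
noncomputable def s (x : ℝ) : ℝ := √((D.b - x) * (x - D.a))

/-- The density. -/
noncomputable def dens (x : ℝ) : ℝ := D.s x * ∑ k, D.α k * x ^ (-1 - D.l k)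

/-- The Cauchy transform of the law of the `r`-th power. -/
noncomputable def G (z : ℂ) : ℂ := ∫ x in D.a..D.b, (D.dens x : ℂ) / (z - ((x ^ D.r : ℝ) : ℂ))

/-- The half length of `[a, b]`. -/
noncomputable def ρ : ℝ := (D.b - D.a) / 2

/-- The Joukowski map for `[a, b]`. -/
noncomputable def J (v : ℂ) : ℂ := joukowski D.a D.b v

/-- The sector on which `z ↦ z ^ r` is injective with image the slit plane. -/
def sector : Set ℂ := {z | z ∈ Complex.slitPlane ∧ D.r * |z.arg| < π}

/-- The uniformized domain of the continued Cauchy transform. -/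
def V : Set ℂ := {v | v.im < 0 ∧ D.r * |(D.J v).arg| < π}

/-- The difference of the kernels `1 / (t ^ r - 1)` and `t ^ (-c) / (r (t - 1))`, with the
singularity at `1` removed. -/
noncomputable def χ (c : ℝ) : ℂ → ℂ :=
  dslope (fun t : ℂ => (dslope (fun t : ℂ => t ^ (D.r : ℂ)) 1 t)⁻¹ - t ^ (-c : ℂ) / D.r) 1

/-- The regular part of the continued Cauchy transform. -/
noncomputable def R (z : ℂ) : ℂ :=
  ∑ k, (D.α k : ℂ) * ∫ x in D.a..D.b,
    ((D.s x * x ^ (-1 - D.l k - D.r) : ℝ) : ℂ) * D.χ (D.l k + D.r) (z / x)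

/-- The analytic continuation of the density divided by its semicircle factor, in the
coordinate `x`. -/
noncomputable def q (z : ℂ) : ℂ :=
  (D.r : ℂ)⁻¹ * ∑ k, (D.α k : ℂ) * z ^ (-(D.l k + D.r : ℝ) : ℂ)

/-- The continued Cauchy transform in the uniformizing coordinate. -/
noncomputable def Gt (v : ℂ) : ℂ := D.R (D.J v) + π * D.ρ * v * D.q (D.J v)

theorem r_pos : 0 < D.r := one_pos.trans_le D.hr

theorem r_ne : (D.r : ℂ) ≠ 0 := by exact_mod_cast D.r_pos.ne'

theorem b_pos : 0 < D.b := D.ha.trans D.hab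

theorem ρ_pos : 0 < D.ρ := by unfold ρ; linarith [D.hab]

theorem isOpen_sector : IsOpen D.sector := by
  have h : ContinuousOn (fun z : ℂ => D.r * |z.arg|) Complex.slitPlane := fun z hz =>
    (((Complex.continuousAt_arg hz).abs).const_mul _).continuousWithinAt
  exact h.isOpen_inter_preimage Complex.isOpen_slitPlane isOpen_Iio

theorem ofReal_mem_sector {x : ℝ} (hx : 0 < x) : (x : ℂ) ∈ D.sector := by
  refine ⟨Complex.ofReal_mem_slitPlane.2 hx, ?_⟩
  simp [Complex.arg_ofReal_of_nonneg hx.le, Real.pi_pos]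

theorem one_mem_sector : (1 : ℂ) ∈ D.sector := by
  simpa using D.ofReal_mem_sector one_pos

theorem ne_zero_of_mem_sector {z : ℂ} (hz : z ∈ D.sector) : z ≠ 0 :=
  Complex.slitPlane_ne_zero hz.1

theorem div_mem_sector {z : ℂ} (hz : z ∈ D.sector) {x : ℝ} (hx : 0 < x) : z / x ∈ D.sector := by
  have h0 := D.ne_zero_of_mem_sector hz
  have harg : (z / x).arg = z.arg := by
    rw [div_eq_mul_inv, mul_comm, ← Complex.ofReal_inv, Complex.arg_real_mul _ (inv_pos.2 hx)]
  refine ⟨?_, by rw [harg]; exact hz.2⟩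
  rw [Complex.mem_slitPlane_iff_arg, harg]
  refine ⟨(Complex.mem_slitPlane_iff_arg.1 hz.1).1, div_ne_zero h0 ?_⟩
  exact_mod_cast hx.ne'

/-- On the sector `r * arg z` stays in `(-π, π)`, so no multiple of `2πi` appears; injectivity of
the power follows. -/
theorem log_cpow {z : ℂ} (hz : z ∈ D.sector) :
    Complex.log (z ^ (D.r : ℂ)) = D.r * Complex.log z := by
  have h0 := D.ne_zero_of_mem_sector hz
  have h1 := abs_lt.1 (show |D.r * z.arg| < π by rw [abs_mul, abs_of_pos D.r_pos]; exact hz.2)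
  rw [Complex.cpow_def_of_ne_zero h0, mul_comm, Complex.log_exp]
  · rw [Complex.im_ofReal_mul, Complex.log_im]
    exact h1.1
  · rw [Complex.im_ofReal_mul, Complex.log_im]
    exact h1.2.le

theorem injOn_cpow : InjOn (fun z : ℂ => z ^ (D.r : ℂ)) D.sector := by
  intro z hz z' hz' h
  have h1 := congrArg Complex.log h
  simp only [D.log_cpow hz, D.log_cpow hz'] at h1
  have h2 := mul_left_cancel₀ D.r_ne h1
  rw [← Complex.exp_log (D.ne_zero_of_mem_sector hz), h2,
    Complex.exp_log (D.ne_zero_of_mem_sector hz')]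

theorem cpow_ne_one {z : ℂ} (hz : z ∈ D.sector) (h1 : z ≠ 1) : z ^ (D.r : ℂ) ≠ 1 := by
  intro h
  exact h1 (D.injOn_cpow hz D.one_mem_sector (by simpa using h))

theorem differentiableOn_cpow_sector (c : ℂ) :
    DifferentiableOn ℂ (fun z : ℂ => z ^ c) D.sector := fun _ hz =>
  (differentiableAt_id.cpow (differentiableAt_const _) hz.1).differentiableWithinAt

theorem dslope_cpow_ne_zero {z : ℂ} (hz : z ∈ D.sector) :
    dslope (fun t : ℂ => t ^ (D.r : ℂ)) 1 z ≠ 0 := by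
  by_cases h : z = 1
  · subst h
    have h1 : HasDerivAt (fun t : ℂ => t ^ (D.r : ℂ)) (D.r * 1 ^ ((D.r : ℂ) - 1) * 1) 1 :=
      (hasDerivAt_id (1 : ℂ)).cpow_const Complex.one_mem_slitPlane
    rw [dslope_same, h1.deriv]
    simpa using D.r_ne
  · rw [dslope_of_ne _ h, slope_def_field]
    refine div_ne_zero (sub_ne_zero.2 ?_) (sub_ne_zero.2 h)
    simpa using D.cpow_ne_one hz h

/-- The inner quotient `(t - 1) / (t ^ r - 1)` is holomorphic because `t ^ r = 1` only at `t = 1` in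
the sector, with nonzero derivative there. It equals `1 / r` at `1`, as does `t ^ (-c) / r`, so the
pole cancels. -/
theorem differentiableOn_χ (c : ℝ) : DifferentiableOn ℂ (D.χ c) D.sector := by
  have hn : D.sector ∈ 𝓝 (1 : ℂ) := D.isOpen_sector.mem_nhds D.one_mem_sector
  refine (Complex.differentiableOn_dslope hn).2 ?_
  refine DifferentiableOn.sub (DifferentiableOn.inv ?_ fun z hz => D.dslope_cpow_ne_zero hz) ?_
  · exact (Complex.differentiableOn_dslope hn).2 (D.differentiableOn_cpow_sector _)
  · exact (D.differentiableOn_cpow_sector _).div_const _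

theorem χ_of_ne (c : ℝ) {t : ℂ} (ht : t ∈ D.sector) (h1 : t ≠ 1) :
    D.χ c t = 1 / (t ^ (D.r : ℂ) - 1) - t ^ (-c : ℂ) / (D.r * (t - 1)) := by
  have hd : deriv (fun t : ℂ => t ^ (D.r : ℂ)) 1 = D.r := by
    have h1 : HasDerivAt (fun t : ℂ => t ^ (D.r : ℂ)) (D.r * 1 ^ ((D.r : ℂ) - 1) * 1) 1 :=
      (hasDerivAt_id (1 : ℂ)).cpow_const Complex.one_mem_slitPlane
    simpa using h1.deriv
  have h2 := sub_ne_zero.2 h1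
  have h3 := sub_ne_zero.2 (D.cpow_ne_one ht h1)
  have h4 := D.r_ne
  rw [χ, dslope_of_ne _ h1, slope_def_field, dslope_of_ne _ h1, slope_def_field, dslope_same, hd]
  simp only [Complex.one_cpow]
  field_simp
  ring

theorem im_χ_ofReal (c : ℝ) {x : ℝ} (hx : 0 < x) : (D.χ c x).im = 0 := by
  have hne : ∀ x : ℝ, 0 < x → x ≠ 1 → (D.χ c x).im = 0 := by
    intro x hx h1
    rw [D.χ_of_ne c (D.ofReal_mem_sector hx) (by exact_mod_cast h1), ← Complex.ofReal_neg,
      ← Complex.ofReal_cpow hx.le, ← Complex.ofReal_cpow hx.le]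
    norm_cast
  -- The explicit formula fails at `1`; the value there is obtained by continuity along real points.
  by_cases h1 : x = 1
  · subst h1
    have hc : ContinuousAt (fun x : ℝ => (D.χ c x).im) 1 := by
      have h1 : ContinuousAt (D.χ c) ((1 : ℝ) : ℂ) := by
        rw [Complex.ofReal_one]
        exact ((D.differentiableOn_χ c).continuousOn).continuousAt
          (D.isOpen_sector.mem_nhds D.one_mem_sector)
      exact Complex.continuous_im.continuousAt.comp
        (h1.comp Complex.continuous_ofReal.continuousAt)
    have h2 : Tendsto (fun x : ℝ => (D.χ c x).im) (𝓝[≠] 1) (𝓝 ((D.χ c (1 : ℝ)).im)) :=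
      hc.tendsto.mono_left nhdsWithin_le_nhds
    refine tendsto_nhds_unique h2 (tendsto_const_nhds.congr' ?_)
    filter_upwards [self_mem_nhdsWithin, nhdsWithin_le_nhds (lt_mem_nhds one_pos)] with y h3 h4
    exact (hne y h4 h3).symm
  · exact hne x hx h1

theorem continuous_s : Continuous D.s := by unfold s; fun_prop

theorem continuousOn_rpow_const (c : ℝ) : ContinuousOn (fun x : ℝ => x ^ c) (Icc D.a D.b) :=
  fun _ hx => (Real.continuousAt_rpow_const _ _
    (Or.inl (D.ha.trans_le hx.1).ne')).continuousWithinAt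

theorem continuousOn_dens : ContinuousOn D.dens (Icc D.a D.b) := by
  unfold dens
  refine D.continuous_s.continuousOn.mul (continuousOn_finsetSum _ fun k _ => ?_)
  exact (D.continuousOn_rpow_const _).const_mul _

theorem continuousOn_R_integrand (k : Fin N) :
    ContinuousOn (Function.uncurry fun (z : ℂ) (x : ℝ) =>
      ((D.s x * x ^ (-1 - D.l k - D.r) : ℝ) : ℂ) * D.χ (D.l k + D.r) (z / x))
      (D.sector ×ˢ Icc D.a D.b) := by
  refine ContinuousOn.mul ?_ ?_
  · refine Complex.continuous_ofReal.comp_continuousOn ?_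
    exact (D.continuous_s.continuousOn.mul (D.continuousOn_rpow_const _)).comp
      continuousOn_snd fun p hp => hp.2
  · refine (D.differentiableOn_χ _).continuousOn.comp (f := fun p : ℂ × ℝ => p.1 / (p.2 : ℂ)) ?_ ?_
    · refine ContinuousOn.div (by fun_prop) (by fun_prop) fun p hp => ?_
      exact_mod_cast (D.ha.trans_le hp.2.1).ne'
    · exact fun p hp => D.div_mem_sector hp.1 (D.ha.trans_le hp.2.1)

theorem differentiableOn_R : DifferentiableOn ℂ D.R D.sector := by
  unfold R
  refine DifferentiableOn.fun_sum fun k _ => DifferentiableOn.const_mul ?_ _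
  refine differentiableOn_intervalIntegral D.isOpen_sector D.hab.le
    (D.continuousOn_R_integrand k) fun x hx => ?_
  refine DifferentiableOn.const_mul ?_ _
  refine (D.differentiableOn_χ _).comp (f := fun z : ℂ => z / x)
    (differentiableOn_id.div_const _) ?_
  exact fun z hz => D.div_mem_sector hz (D.ha.trans_le hx.1)

theorem differentiableOn_q : DifferentiableOn ℂ D.q Complex.slitPlane := by
  unfold q
  refine DifferentiableOn.const_mul (DifferentiableOn.fun_sum fun k _ =>
    DifferentiableOn.const_mul (fun z hz => ?_) _) _
  exact (differentiableAt_id.cpow (differentiableAt_const _) hz).differentiableWithinAt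

theorem im_intervalIntegral_eq_zero {f : ℝ → ℂ}
    (h : ∀ x ∈ Icc D.a D.b, (f x).im = 0) : (∫ x in D.a..D.b, f x).im = 0 := by
  have h1 : ∫ x in D.a..D.b, f x = ((∫ x in D.a..D.b, (f x).re : ℝ) : ℂ) := by
    rw [← intervalIntegral.integral_ofReal]
    refine intervalIntegral.integral_congr fun x hx => ?_
    rw [uIcc_of_le D.hab.le] at hx
    exact Complex.ext (by simp) (by simp [h x hx])
  rw [h1, Complex.ofReal_im]

theorem im_R_ofReal {x : ℝ} (hx : 0 < x) : (D.R x).im = 0 := by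
  unfold R
  rw [Complex.im_sum]
  refine Finset.sum_eq_zero fun k _ => ?_
  rw [Complex.im_ofReal_mul, mul_eq_zero]
  right
  refine D.im_intervalIntegral_eq_zero fun y hy => ?_
  rw [Complex.im_ofReal_mul, ← Complex.ofReal_div,
    D.im_χ_ofReal _ (div_pos hx (D.ha.trans_le hy.1)), mul_zero]

theorem im_q_ofReal {x : ℝ} (hx : 0 < x) : (D.q x).im = 0 := by
  unfold q
  have : ∀ k, (x : ℂ) ^ (-(D.l k + D.r : ℝ) : ℂ) = ((x ^ (-(D.l k + D.r)) : ℝ) : ℂ) := by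
    intro k
    rw [Complex.ofReal_cpow hx.le]; push_cast; rfl
  simp_rw [this]
  norm_cast

/-! ### The Cauchy transform off the support and at infinity. -/

/-- The points off the support of the law of the `r`-th power. -/
def offSupport : Set ℂ := {z | ∀ x ∈ Icc D.a D.b, z ≠ ((x ^ D.r : ℝ) : ℂ)}

theorem isOpen_offSupport : IsOpen D.offSupport := by
  have : D.offSupport = ((fun x : ℝ => ((x ^ D.r : ℝ) : ℂ)) '' Icc D.a D.b)ᶜ := by
    ext z
    simp only [offSupport, mem_ofPred_eq, mem_compl_iff, mem_image, not_exists, not_and]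
    exact forall₂_congr fun x _ => ⟨fun h e => h e.symm, fun h e => h e.symm⟩
  rw [this]
  refine (IsCompact.isClosed ?_).isOpen_compl
  exact isCompact_Icc.image_of_continuousOn
    (Complex.continuous_ofReal.comp_continuousOn (D.continuousOn_rpow_const _))

theorem continuousOn_G_integrand : ContinuousOn (Function.uncurry fun (z : ℂ) (x : ℝ) =>
    (D.dens x : ℂ) / (z - ((x ^ D.r : ℝ) : ℂ))) (D.offSupport ×ˢ Icc D.a D.b) := by
  refine ContinuousOn.div ?_ (continuousOn_fst.sub ?_) fun p hp => sub_ne_zero.2 (hp.1 _ hp.2)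
  · exact (Complex.continuous_ofReal.comp_continuousOn D.continuousOn_dens).comp
      continuousOn_snd fun p hp => hp.2
  · exact (Complex.continuous_ofReal.comp_continuousOn (D.continuousOn_rpow_const _)).comp
      continuousOn_snd fun p hp => hp.2

theorem differentiableOn_G : DifferentiableOn ℂ D.G D.offSupport := by
  refine differentiableOn_intervalIntegral D.isOpen_offSupport D.hab.le
    D.continuousOn_G_integrand fun x hx => ?_
  exact DifferentiableOn.div (by fun_prop) (by fun_prop) fun z hz => sub_ne_zero.2 (hz x hx)

theorem continuousAt_G {z : ℂ} (hz : z ∈ D.offSupport) : ContinuousAt D.G z :=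
  D.differentiableOn_G.continuousOn.continuousAt (D.isOpen_offSupport.mem_nhds hz)

theorem im_G_ofReal (x : ℝ) : (D.G x).im = 0 := by
  refine D.im_intervalIntegral_eq_zero fun y hy => ?_
  norm_cast

theorem ofReal_mem_offSupport {x : ℝ} (hx : x ≤ 0) : (x : ℂ) ∈ D.offSupport := by
  intro y hy h
  have := Real.rpow_pos_of_pos (D.ha.trans_le hy.1) D.r
  have h' : x = y ^ D.r := by exact_mod_cast h
  linarith

/-- The Cauchy transform in the coordinate `1 / z`, divided by the coordinate. -/
noncomputable def Φ (u : ℂ) : ℂ := ∫ x in D.a..D.b, (D.dens x : ℂ) / (1 - u * ((x ^ D.r : ℝ) : ℂ))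

theorem G_eq_Φ {z : ℂ} (hz : z ≠ 0) : D.G z = z⁻¹ * D.Φ z⁻¹ := by
  rw [G, Φ, ← intervalIntegral.integral_const_mul]
  congr 1
  ext x
  rw [show 1 - z⁻¹ * ((x ^ D.r : ℝ) : ℂ) = z⁻¹ * (z - ((x ^ D.r : ℝ) : ℂ)) by field_simp]
  rw [← mul_div_assoc, mul_div_mul_left _ _ (inv_ne_zero hz)]

theorem differentiableOn_Φ : DifferentiableOn ℂ D.Φ (ball 0 (D.b ^ D.r)⁻¹) := by
  have hb := Real.rpow_pos_of_pos D.b_pos D.r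
  have hne : ∀ u ∈ ball (0 : ℂ) (D.b ^ D.r)⁻¹, ∀ x ∈ Icc D.a D.b,
      1 - u * ((x ^ D.r : ℝ) : ℂ) ≠ 0 := by
    intro u hu x hx h
    have h1 : u * ((x ^ D.r : ℝ) : ℂ) = 1 := by linear_combination -h
    have hx0 := D.ha.trans_le hx.1
    have h2 : ‖u‖ * x ^ D.r = 1 := by
      have := congrArg norm h1
      rwa [norm_mul, Complex.norm_real, Real.norm_of_nonneg (Real.rpow_nonneg hx0.le _),
        norm_one] at this
    have h3 : ‖u‖ < (D.b ^ D.r)⁻¹ := by simpa using hu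
    have h4 : x ^ D.r ≤ D.b ^ D.r := Real.rpow_le_rpow hx0.le hx.2 D.r_pos.le
    have h5 : ‖u‖ * D.b ^ D.r < 1 := by 
      rwa [← one_div, lt_div_iff₀ hb] at h3
    have h6 := mul_le_mul_of_nonneg_left h4 (norm_nonneg u)
    linarith
  refine differentiableOn_intervalIntegral isOpen_ball D.hab.le ?_ fun x hx => ?_
  · refine ContinuousOn.div ?_ (continuousOn_const.sub (continuousOn_fst.mul ?_))
      fun p hp => hne _ hp.1 _ hp.2
    · exact (Complex.continuous_ofReal.comp_continuousOn D.continuousOn_dens).comp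
        continuousOn_snd fun p hp => hp.2
    · exact (Complex.continuous_ofReal.comp_continuousOn (D.continuousOn_rpow_const _)).comp
        continuousOn_snd fun p hp => hp.2
  · exact DifferentiableOn.div (by fun_prop) (by fun_prop) fun z hz => hne z hz x hx

theorem Φ_zero : D.Φ 0 = 1 := by
  have h := D.mass
  simp only [Φ, zero_mul, sub_zero, div_one]
  rw [intervalIntegral.integral_ofReal]
  rw [← Complex.ofReal_one, ← h]
  rfl

theorem analyticAt_Φ : AnalyticAt ℂ D.Φ 0 :=
  D.differentiableOn_Φ.analyticAt
    (ball_mem_nhds _ (inv_pos.2 (Real.rpow_pos_of_pos D.b_pos D.r)))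

theorem tendsto_G_cobounded : Tendsto D.G (Bornology.cobounded ℂ) (𝓝 0) := by
  have h1 : Tendsto (fun z : ℂ => z⁻¹ * D.Φ z⁻¹) (Bornology.cobounded ℂ) (𝓝 (0 * D.Φ 0)) :=
    tendsto_inv₀_cobounded.mul
      (D.analyticAt_Φ.continuousAt.tendsto.comp tendsto_inv₀_cobounded)
  rw [zero_mul] at h1
  refine h1.congr' ?_
  filter_upwards [Bornology.eventually_ne_cobounded (0 : ℂ)] with z hz
  exact (D.G_eq_Φ hz).symm

/-- The Cauchy transform of the semicircle factor. -/
noncomputable def S (z : ℂ) : ℂ := ∫ x in D.a..D.b, (D.s x : ℂ) / (z - x)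

/-- With exponent `l k + r` in `χ`, the singular term `x ^ (-1 - l k - r) * (z / x) ^ (-(l k + r)) /
(r (z / x - 1))` becomes `z ^ (-(l k + r)) / (r (z - x))`. The dependence on `k` leaves the
integral, and only `S` remains. -/
theorem R_eq {z : ℂ} (hz : z ∈ D.sector) (hx : ∀ x ∈ Icc D.a D.b, z ≠ x) :
    D.R z = D.G (z ^ (D.r : ℂ)) - D.q z * D.S z := by
  have hz0 := D.ne_zero_of_mem_sector hz
  have hpow : ∀ x ∈ Icc D.a D.b, (z / x) ^ (D.r : ℂ) = z ^ (D.r : ℂ) / ((x ^ D.r : ℝ) : ℂ) := by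
    intro x hx
    have hx0 := D.ha.trans_le hx.1
    rw [div_eq_inv_mul, ← Complex.ofReal_inv, cpow_ofReal_mul (inv_pos.2 hx0) hz0,
      ← Complex.ofReal_cpow (inv_pos.2 hx0).le, Real.inv_rpow hx0.le]
    push_cast; ring
  have hpt : ∀ k, ∀ x ∈ Icc D.a D.b,
      ((D.s x * x ^ (-1 - D.l k - D.r) : ℝ) : ℂ) * D.χ (D.l k + D.r) (z / x) =
      ((D.s x * x ^ (-1 - D.l k) : ℝ) : ℂ) / (z ^ (D.r : ℂ) - ((x ^ D.r : ℝ) : ℂ)) -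
      (D.r : ℂ)⁻¹ * z ^ (-(D.l k + D.r : ℝ) : ℂ) * ((D.s x : ℂ) / (z - x)) := by
    intro k x hxI
    have hx0 := D.ha.trans_le hxI.1
    have hxc : (x : ℂ) ≠ 0 := by exact_mod_cast hx0.ne'
    have hne1 : z / x ≠ 1 := fun h => hx x hxI (by field_simp at h; exact h)
    have hsec := D.div_mem_sector hz hx0
    have h3 := D.cpow_ne_one hsec hne1
    rw [D.χ_of_ne _ hsec hne1]
    rw [hpow x hxI] at h3 ⊢
    have hxr := Real.rpow_pos_of_pos hx0 D.r
    have hxr' : ((x ^ D.r : ℝ) : ℂ) ≠ 0 := by exact_mod_cast hxr.ne'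
    have hxl := Real.rpow_pos_of_pos hx0 (D.l k)
    have hxl' : ((x ^ D.l k : ℝ) : ℂ) ≠ 0 := by exact_mod_cast hxl.ne'
    have e1 : (z / x) ^ (-(D.l k + D.r : ℝ) : ℂ) =
        ((x ^ D.l k : ℝ) : ℂ) * ((x ^ D.r : ℝ) : ℂ) * z ^ (-(D.l k + D.r : ℝ) : ℂ) := by
      rw [div_eq_inv_mul, ← Complex.ofReal_inv, cpow_ofReal_mul (inv_pos.2 hx0) hz0,
        ← Complex.ofReal_neg, ← Complex.ofReal_cpow (inv_pos.2 hx0).le, Real.inv_rpow hx0.le,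
        Real.rpow_neg hx0.le, inv_inv, Real.rpow_add hx0]
      push_cast; ring
    have e2 : x ^ (-1 - D.l k - D.r) = (x * x ^ D.l k * x ^ D.r)⁻¹ := by
      rw [show -1 - D.l k - D.r = -(1 + D.l k + D.r) by ring, Real.rpow_neg hx0.le,
        Real.rpow_add hx0, Real.rpow_add hx0, Real.rpow_one]
    have e3 : x ^ (-1 - D.l k) = (x * x ^ D.l k)⁻¹ := by
      rw [show -1 - D.l k = -(1 + D.l k) by ring, Real.rpow_neg hx0.le,
        Real.rpow_add hx0, Real.rpow_one]
    rw [e1, e2, e3]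
    have h4 : z - x ≠ 0 := sub_ne_zero.2 (hx x hxI)
    have h5 : z ^ (D.r : ℂ) - ((x ^ D.r : ℝ) : ℂ) ≠ 0 := by
      intro h; apply h3; rw [sub_eq_zero.1 h, div_self hxr']
    have h6 : z / x - 1 = (z - x) / x := by field_simp
    have h7 : z ^ (D.r : ℂ) / ((x ^ D.r : ℝ) : ℂ) - 1 =
        (z ^ (D.r : ℂ) - ((x ^ D.r : ℝ) : ℂ)) / ((x ^ D.r : ℝ) : ℂ) := by field_simp
    rw [h6, h7]
    have := D.r_ne
    push_cast at *
    field_simp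
  have hoff : ∀ x ∈ Icc D.a D.b, z ^ (D.r : ℂ) - ((x ^ D.r : ℝ) : ℂ) ≠ 0 := by
    intro x hxI h
    have hx0 := D.ha.trans_le hxI.1
    refine hx x hxI (D.injOn_cpow hz (D.ofReal_mem_sector hx0) ?_)
    simp only
    rw [sub_eq_zero.1 h, Complex.ofReal_cpow hx0.le]
  have hA : ∀ k, IntervalIntegrable (fun x : ℝ =>
      ((D.s x * x ^ (-1 - D.l k) : ℝ) : ℂ) / (z ^ (D.r : ℂ) - ((x ^ D.r : ℝ) : ℂ)))
      volume D.a D.b := by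
    intro k
    refine ContinuousOn.intervalIntegrable_of_Icc D.hab.le ?_
    refine ContinuousOn.div ?_ (continuousOn_const.sub ?_) hoff
    · exact Complex.continuous_ofReal.comp_continuousOn
        (D.continuous_s.continuousOn.mul (D.continuousOn_rpow_const _))
    · exact Complex.continuous_ofReal.comp_continuousOn (D.continuousOn_rpow_const _)
  have hB : IntervalIntegrable (fun x : ℝ => (D.s x : ℂ) / (z - x)) volume D.a D.b := by
    refine ContinuousOn.intervalIntegrable_of_Icc D.hab.le ?_
    refine ContinuousOn.div ?_ (by fun_prop) fun x hxI => sub_ne_zero.2 (hx x hxI)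
    exact (Complex.continuous_ofReal.comp D.continuous_s).continuousOn
  have hG : D.G (z ^ (D.r : ℂ)) = ∑ k, (D.α k : ℂ) * ∫ x in D.a..D.b,
      ((D.s x * x ^ (-1 - D.l k) : ℝ) : ℂ) / (z ^ (D.r : ℂ) - ((x ^ D.r : ℝ) : ℂ)) := by
    simp_rw [← intervalIntegral.integral_const_mul]
    rw [← intervalIntegral.integral_finsetSum fun k _ => (hA k).const_mul _]
    refine intervalIntegral.integral_congr fun x _ => ?_
    simp only [dens]
    push_cast
    rw [Finset.mul_sum, Finset.sum_div]
    exact Finset.sum_congr rfl fun k _ => by ring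
  rw [hG, R, q, S, Finset.mul_sum, Finset.sum_mul, ← Finset.sum_sub_distrib]
  refine Finset.sum_congr rfl fun k _ => ?_
  rw [intervalIntegral.integral_congr (g := fun x =>
    ((D.s x * x ^ (-1 - D.l k) : ℝ) : ℂ) / (z ^ (D.r : ℂ) - ((x ^ D.r : ℝ) : ℂ)) -
      (D.r : ℂ)⁻¹ * z ^ (-(D.l k + D.r : ℝ) : ℂ) * ((D.s x : ℂ) / (z - x)))
    fun x hxI => hpt k x (by rwa [uIcc_of_le D.hab.le] at hxI),
    intervalIntegral.integral_sub (hA k) (hB.const_mul _), intervalIntegral.integral_const_mul]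
  ring

/-! ### The Joukowski coordinate and the continuation across `(a, b)`. -/

theorem J_eq (v : ℂ) : D.J v = ((D.a + D.b) / 2 : ℝ) + (D.ρ : ℂ) * ((v + v⁻¹) / 2) := rfl

theorem J_inv (v : ℂ) : D.J v⁻¹ = D.J v := by
  rw [J_eq, J_eq, inv_inv, add_comm v]

theorem J_re (v : ℂ) :
    (D.J v).re = (D.a + D.b) / 2 + D.ρ * v.re * (1 + (Complex.normSq v)⁻¹) / 2 := by
  have : D.J v = (((D.a + D.b) / 2 : ℝ) : ℂ) + ((D.ρ / 2 : ℝ) : ℂ) * (v + v⁻¹) := by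
    rw [J_eq]; push_cast; ring
  rw [this, Complex.add_re, Complex.ofReal_re, Complex.re_ofReal_mul, Complex.add_re,
    Complex.inv_re]
  ring

theorem J_im (v : ℂ) :
    (D.J v).im = D.ρ * v.im * (1 - (Complex.normSq v)⁻¹) / 2 := by
  have : D.J v = (((D.a + D.b) / 2 : ℝ) : ℂ) + ((D.ρ / 2 : ℝ) : ℂ) * (v + v⁻¹) := by
    rw [J_eq]; push_cast; ring
  rw [this, Complex.add_im, Complex.ofReal_im, Complex.im_ofReal_mul, Complex.add_im,
    Complex.inv_im]
  ring

theorem J_mem_Icc {v : ℂ} (hv : ‖v‖ = 1) : ∃ x ∈ Icc D.a D.b, D.J v = x := by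
  have h1 : Complex.normSq v = 1 := by rw [Complex.normSq_eq_norm_sq, hv, one_pow]
  have h2 := abs_le.1 (hv ▸ Complex.abs_re_le_norm v)
  have hρ := D.ρ_pos
  refine ⟨(D.a + D.b) / 2 + D.ρ * v.re, ⟨?_, ?_⟩, Complex.ext ?_ ?_⟩
  · have : D.a = (D.a + D.b) / 2 + D.ρ * (-1) := by unfold ρ; ring
    nlinarith [h2.1]
  · have : D.b = (D.a + D.b) / 2 + D.ρ * 1 := by unfold ρ; ring
    nlinarith [h2.2]
  · rw [J_re, h1, Complex.ofReal_re]; ring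
  · rw [J_im, h1, Complex.ofReal_im]; ring

theorem im_J_pos {v : ℂ} (hv : v.im < 0) (h1 : ‖v‖ < 1) : 0 < (D.J v).im := by
  have h0 : v ≠ 0 := by rintro rfl; simp at hv
  have h2 : 0 < Complex.normSq v := Complex.normSq_pos.2 h0
  have h3 : Complex.normSq v < 1 := by
    rw [Complex.normSq_eq_norm_sq]; nlinarith [norm_nonneg v]
  have h4 : 1 < (Complex.normSq v)⁻¹ := one_lt_inv_iff₀.2 ⟨h2, h3⟩
  rw [J_im]
  nlinarith [mul_pos D.ρ_pos (neg_pos.2 hv)]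

theorem im_J_neg {v : ℂ} (hv : v.im < 0) (h1 : 1 < ‖v‖) : (D.J v).im < 0 := by
  have h3 : 1 < Complex.normSq v := by
    rw [Complex.normSq_eq_norm_sq]; nlinarith [norm_nonneg v]
  have h4 : (Complex.normSq v)⁻¹ < 1 := inv_lt_one_of_one_lt₀ h3
  rw [J_im]
  nlinarith [mul_pos D.ρ_pos (neg_pos.2 hv)]

theorem J_ne_zero {v : ℂ} (hv : v.im < 0) : D.J v ≠ 0 := by
  intro h
  rcases lt_trichotomy ‖v‖ 1 with h1 | h1 | h1
  · exact (D.im_J_pos hv h1).ne' (by rw [h, Complex.zero_im])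
  · obtain ⟨x, hx, hxv⟩ := D.J_mem_Icc h1
    have : x = 0 := by exact_mod_cast hxv.symm.trans h
    linarith [D.ha, hx.1]
  · exact (D.im_J_neg hv h1).ne (by rw [h, Complex.zero_im])

theorem J_mem_sector {v : ℂ} (hv : v ∈ D.V) : D.J v ∈ D.sector := by
  refine ⟨Complex.mem_slitPlane_iff_arg.2 ⟨fun h => ?_, D.J_ne_zero hv.1⟩, hv.2⟩
  have h1 := hv.2
  rw [h, abs_of_pos Real.pi_pos] at h1
  nlinarith [D.hr, Real.pi_pos]

theorem differentiableAt_J {v : ℂ} (hv : v ≠ 0) : DifferentiableAt ℂ D.J v := by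
  have : D.J = fun v => (((D.a + D.b) / 2 : ℝ) : ℂ) + (D.ρ : ℂ) * ((v + v⁻¹) / 2) := rfl
  rw [this]
  exact (((differentiableAt_id.add (differentiableAt_inv hv)).div_const _).const_mul _).const_add _

theorem ne_zero_of_im_neg {v : ℂ} (hv : v.im < 0) : v ≠ 0 := by rintro rfl; simp at hv

theorem V_eq : D.V = {v : ℂ | v.im < 0} ∩ D.J ⁻¹' D.sector := by
  ext v
  exact ⟨fun h => ⟨h.1, D.J_mem_sector h⟩, fun h => ⟨h.1, h.2.2⟩⟩

theorem isOpen_V : IsOpen D.V := by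
  rw [V_eq]
  refine ContinuousOn.isOpen_inter_preimage (fun v hv => ?_)
    (isOpen_lt Complex.continuous_im continuous_const) D.isOpen_sector
  exact (D.differentiableAt_J (ne_zero_of_im_neg hv)).continuousAt.continuousWithinAt

theorem differentiableAt_Gt {v : ℂ} (hv : v ≠ 0) (h : D.J v ∈ D.sector) :
    DifferentiableAt ℂ D.Gt v := by
  have hJ := D.differentiableAt_J hv
  have h1 : DifferentiableAt ℂ D.R (D.J v) :=
    D.differentiableOn_R.differentiableAt (D.isOpen_sector.mem_nhds h)
  have h2 : DifferentiableAt ℂ D.q (D.J v) :=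
    D.differentiableOn_q.differentiableAt (Complex.isOpen_slitPlane.mem_nhds h.1)
  exact (h1.comp v hJ).add ((differentiableAt_id.const_mul _).mul (h2.comp v hJ))

theorem differentiableOn_Gt : DifferentiableOn ℂ D.Gt D.V := fun _ hv =>
  (D.differentiableAt_Gt (ne_zero_of_im_neg hv.1) (D.J_mem_sector hv)).differentiableWithinAt

theorem S_J {v : ℂ} (hv : ‖v‖ < 1) (hv0 : v ≠ 0) : D.S (D.J v) = π * D.ρ * v :=
  integral_sqrt_div_joukowski_sub D.hab hv hv0

theorem J_ne_ofReal {v : ℂ} (hv : v.im < 0) (h1 : ‖v‖ ≠ 1) (x : ℝ) : D.J v ≠ x := by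
  intro h
  have h2 : (D.J v).im = 0 := by rw [h, Complex.ofReal_im]
  rcases lt_or_gt_of_ne h1 with h1 | h1
  · exact (D.im_J_pos hv h1).ne' h2
  · exact (D.im_J_neg hv h1).ne h2

theorem Gt_of_norm_lt {v : ℂ} (hv : v ∈ D.V) (h1 : ‖v‖ < 1) :
    D.Gt v = D.G (D.J v ^ (D.r : ℂ)) := by
  rw [Gt, D.R_eq (D.J_mem_sector hv) fun x _ => D.J_ne_ofReal hv.1 h1.ne x,
    D.S_J h1 (ne_zero_of_im_neg hv.1)]
  ring

/-- Outside the disc `S (J v)` is computed from `v⁻¹`, whereas `Gt` uses `v`; the difference is the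
term added to the original Cauchy transform on the second sheet. -/
theorem Gt_of_lt_norm {v : ℂ} (hv : v ∈ D.V) (h1 : 1 < ‖v‖) :
    D.Gt v = D.G (D.J v ^ (D.r : ℂ)) + π * D.ρ * (v - v⁻¹) * D.q (D.J v) := by
  have h2 : D.S (D.J v) = π * D.ρ * v⁻¹ := by
    rw [← D.J_inv, D.S_J (by rw [norm_inv]; exact inv_lt_one_of_one_lt₀ h1)
      (inv_ne_zero (ne_zero_of_im_neg hv.1))]
  rw [Gt, D.R_eq (D.J_mem_sector hv) fun x _ => D.J_ne_ofReal hv.1 h1.ne' x, h2]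
  ring

/-- Equal values force `v = w` or `v * w = 1`, and inversion exchanges the two half-planes. -/
theorem injOn_J : InjOn D.J {v | v.im < 0} := by
  intro v hv w hw h
  have hv0 := ne_zero_of_im_neg hv
  have hw0 := ne_zero_of_im_neg hw
  rw [J_eq, J_eq] at h
  have hρ : (D.ρ : ℂ) ≠ 0 := by exact_mod_cast D.ρ_pos.ne'
  have h1 := mul_left_cancel₀ hρ (add_left_cancel h)
  have h2 : (v - w) * (v * w - 1) = 0 := by
    field_simp at h1
    linear_combination h1
  rcases mul_eq_zero.1 h2 with h3 | h3
  · exact sub_eq_zero.1 h3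
  · exfalso
    have h4 : v = w⁻¹ := eq_inv_of_mul_eq_one_left (sub_eq_zero.1 h3)
    have h5 : v.im = -w.im / Complex.normSq w := by rw [h4, Complex.inv_im]
    have h6 : 0 < -w.im / Complex.normSq w :=
      div_pos (neg_pos.2 hw) (Complex.normSq_pos.2 hw0)
    have hv' : v.im < 0 := hv
    linarith

end PowerData

/-! ### Boundary behaviour of the continued Cauchy transform. -/

theorem ultrafilter_le_cobounded_or_le_nhds {u : Ultrafilter ℂ} :
    (u : Filter ℂ) ≤ Bornology.cobounded ℂ ∨ ∃ v : ℂ, (u : Filter ℂ) ≤ 𝓝 v := by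
  by_cases h : ∃ R : ℝ, closedBall (0 : ℂ) R ∈ u
  · obtain ⟨R, hR⟩ := h
    obtain ⟨v, -, hv⟩ := (isCompact_closedBall (0 : ℂ) R).ultrafilter_le_nhds' u hR
    exact Or.inr ⟨v, hv⟩
  · push Not at h
    left
    rw [(hasBasis_cobounded_compl_closedBall (0 : ℂ)).ge_iff]
    exact fun R _ => Ultrafilter.compl_mem_iff_notMem.2 (h R)

namespace PowerData

variable {N : ℕ} (D : PowerData N)

theorem J_eq' (v : ℂ) :
    D.J v = (((D.a + D.b) / 2 : ℝ) : ℂ) + ((D.ρ / 2 : ℝ) : ℂ) * (v + v⁻¹) := by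
  rw [J_eq]; push_cast; ring

theorem tendsto_J_cobounded : Tendsto D.J (Bornology.cobounded ℂ) (Bornology.cobounded ℂ) := by
  rw [← tendsto_norm_atTop_iff_cobounded]
  have h1 : Tendsto (fun v : ℂ => D.ρ / 2 * ‖v‖ + (-(D.ρ / 2) - |(D.a + D.b) / 2|))
      (Bornology.cobounded ℂ) atTop :=
    tendsto_atTop_add_const_right _ _
      (tendsto_norm_cobounded_atTop.const_mul_atTop (half_pos D.ρ_pos))
  refine tendsto_atTop_mono' _ ?_ h1
  filter_upwards [tendsto_norm_cobounded_atTop.eventually_ge_atTop (1 : ℝ)] with v hv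
  have h2 : ‖v⁻¹‖ ≤ 1 := by rw [norm_inv]; exact inv_le_one_of_one_le₀ hv
  have e : ((D.ρ / 2 : ℝ) : ℂ) * v =
      D.J v - (((D.a + D.b) / 2 : ℝ) : ℂ) - ((D.ρ / 2 : ℝ) : ℂ) * v⁻¹ := by rw [J_eq']; ring
  have h3 : ‖((D.ρ / 2 : ℝ) : ℂ) * v‖ ≤
      ‖D.J v‖ + ‖(((D.a + D.b) / 2 : ℝ) : ℂ)‖ + ‖((D.ρ / 2 : ℝ) : ℂ) * v⁻¹‖ := by
    rw [e]
    exact (norm_sub_le _ _).trans (add_le_add_left (norm_sub_le _ _) _)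
  rw [norm_mul, norm_mul, Complex.norm_real, Complex.norm_real, Real.norm_eq_abs,
    Real.norm_eq_abs, abs_of_pos (half_pos D.ρ_pos)] at h3
  nlinarith [D.ρ_pos]

theorem tendsto_cpow_cobounded {c : ℝ} (hc : 0 < c) :
    Tendsto (fun z : ℂ => z ^ (c : ℂ)) (Bornology.cobounded ℂ) (Bornology.cobounded ℂ) := by
  rw [← tendsto_norm_atTop_iff_cobounded]
  simp_rw [Complex.norm_cpow_real]
  exact (tendsto_rpow_atTop hc).comp tendsto_norm_cobounded_atTop

theorem tendsto_cpow_neg_cobounded {c : ℝ} (hc : 0 < c) :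
    Tendsto (fun z : ℂ => z ^ ((-c : ℝ) : ℂ)) (Bornology.cobounded ℂ) (𝓝 0) := by
  rw [tendsto_zero_iff_norm_tendsto_zero]
  simp_rw [Complex.norm_cpow_real]
  exact (tendsto_rpow_neg_atTop hc).comp tendsto_norm_cobounded_atTop

theorem tendsto_cpow_zero {c : ℝ} (hc : 0 < c) :
    Tendsto (fun z : ℂ => z ^ (c : ℂ)) (𝓝 0) (𝓝 0) := by
  rw [tendsto_zero_iff_norm_tendsto_zero]
  simp_rw [Complex.norm_cpow_real]
  have : ContinuousAt (fun z : ℂ => ‖z‖ ^ c) 0 :=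
    ContinuousAt.rpow_const (by fun_prop) (Or.inr hc.le)
  simpa [ContinuousAt, Real.zero_rpow hc.ne'] using this

theorem tendsto_sub_inv_div_J :
    Tendsto (fun v => (v - v⁻¹) / D.J v) (Bornology.cobounded ℂ) (𝓝 ((2 / D.ρ : ℝ) : ℂ)) := by
  have hi : Tendsto (fun v : ℂ => v⁻¹) (Bornology.cobounded ℂ) (𝓝 0) := tendsto_inv₀_cobounded
  have h1 : Tendsto (fun v : ℂ => (1 - v⁻¹ * v⁻¹) / ((((D.a + D.b) / 2 : ℝ) : ℂ) * v⁻¹ +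
      ((D.ρ / 2 : ℝ) : ℂ) * (1 + v⁻¹ * v⁻¹))) (Bornology.cobounded ℂ)
      (𝓝 ((1 - 0 * 0) / ((((D.a + D.b) / 2 : ℝ) : ℂ) * 0 + ((D.ρ / 2 : ℝ) : ℂ) * (1 + 0 * 0)))) := by
    refine Tendsto.div (tendsto_const_nhds.sub (hi.mul hi)) ((hi.const_mul _).add
      ((tendsto_const_nhds.add (hi.mul hi)).const_mul _)) ?_
    have := D.ρ_pos.ne'
    simpa using this
  have e : ((2 / D.ρ : ℝ) : ℂ) =
      (1 - 0 * 0) / ((((D.a + D.b) / 2 : ℝ) : ℂ) * 0 + ((D.ρ / 2 : ℝ) : ℂ) * (1 + 0 * 0)) := by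
    simp
  rw [e]
  refine h1.congr' ?_
  filter_upwards [Bornology.eventually_ne_cobounded (0 : ℂ)] with v hv
  rw [J_eq', ← mul_div_mul_left _ _ hv]
  congr 1 <;> field_simp

/-- Each term is `(v - v⁻¹) / J v`, with limit `2 / ρ`, times `J v ^ (-(l k + r - 1))`, whose
exponent is at most `0`. It is constant exactly when `l k = 0` and `r = 1`; otherwise it tends to
`0`. What matters later is that the limit is real. -/
theorem exists_tendsto_sub_inv_mul_q {u : Filter ℂ} (hu : u ≤ Bornology.cobounded ℂ) :
    ∃ c : ℝ, Tendsto (fun v => (v - v⁻¹) * D.q (D.J v)) u (𝓝 c) := by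
  have hk : ∀ k, ∃ c : ℝ, Tendsto (fun v => (v - v⁻¹) * D.J v ^ (-(D.l k + D.r : ℝ) : ℂ)) u
      (𝓝 c) := by
    intro k
    have h1 : ∃ c : ℝ, Tendsto (fun v => D.J v ^ ((-(D.l k + D.r - 1) : ℝ) : ℂ)) u (𝓝 c) := by
      by_cases h0 : D.l k + D.r - 1 = 0
      · exact ⟨1, by simpa [h0] using tendsto_const_nhds⟩
      · refine ⟨0, ?_⟩
        have : 0 < D.l k + D.r - 1 :=
          lt_of_le_of_ne (by linarith [D.hl0 k, D.hr]) (Ne.symm h0)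
        rw [Complex.ofReal_zero]
        exact (tendsto_cpow_neg_cobounded this).comp (D.tendsto_J_cobounded.mono_left hu)
    obtain ⟨c, hc⟩ := h1
    refine ⟨2 / D.ρ * c, ?_⟩
    rw [Complex.ofReal_mul]
    refine ((D.tendsto_sub_inv_div_J.mono_left hu).mul hc).congr' ?_
    filter_upwards [(D.tendsto_J_cobounded.mono_left hu).eventually
      (Bornology.eventually_ne_cobounded 0)] with v hv
    rw [div_mul_eq_mul_div, mul_div_assoc]
    congr 1
    rw [show (((-(D.l k + D.r - 1) : ℝ)) : ℂ) = (-(D.l k + D.r : ℝ) : ℂ) + 1 by push_cast; ring,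
      Complex.cpow_add _ _ hv, Complex.cpow_one, mul_div_cancel_right₀ _ hv]
  choose c hc using hk
  refine ⟨D.r⁻¹ * ∑ k, D.α k * c k, ?_⟩
  push_cast
  refine ((tendsto_finsetSum Finset.univ fun k _ => (hc k).const_mul (D.α k : ℂ)).const_mul
    (D.r : ℂ)⁻¹).congr fun v => ?_
  simp only [q, Finset.mul_sum]
  exact Finset.sum_congr rfl fun k _ => by ring

theorem eventually_norm_lt {u : Filter ℂ} {v : ℂ} (h : u ≤ 𝓝 v) (hv : ‖v‖ < 1) :
    ∀ᶠ y in u, ‖y‖ < 1 :=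
  h (continuous_norm.continuousAt.eventually (gt_mem_nhds hv))

theorem eventually_lt_norm {u : Filter ℂ} {v : ℂ} (h : u ≤ 𝓝 v) (hv : 1 < ‖v‖) :
    ∀ᶠ y in u, 1 < ‖y‖ :=
  h (continuous_norm.continuousAt.eventually (lt_mem_nhds hv))

/-- For `r = 1` the boundary rays coincide with the cut of `arg`, so the argument of the limit does
not tell from which side it is approached. The limit `θ` of the arguments along the ultrafilter
does, and it also determines the limits of powers. -/
theorem exists_tendsto_arg {u : Ultrafilter ℂ} (hu : D.V ∈ u) {z : ℂ} (hz : z ≠ 0)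
    (hJ : Tendsto D.J u (𝓝 z)) (hzs : z ∉ D.sector) :
    ∃ θ : ℝ, Tendsto (fun v => (D.J v).arg) u (𝓝 θ) ∧ |θ| = π / D.r ∧
      z = ‖z‖ * Complex.exp (θ * Complex.I) := by
  have hr := D.r_pos
  have hmem : Icc (-(π / D.r)) (π / D.r) ∈ u.map fun v => (D.J v).arg := by
    rw [Ultrafilter.mem_map]
    filter_upwards [hu] with v hv
    have := hv.2
    rw [mem_preimage, mem_Icc, ← abs_le, le_div_iff₀ hr]
    linarith
  obtain ⟨θ, hθ, ht⟩ := isCompact_Icc.ultrafilter_le_nhds' _ hmem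
  have ht' : Tendsto (fun v => (D.J v).arg) u (𝓝 θ) := ht
  have hz' : z = ‖z‖ * Complex.exp (θ * Complex.I) := by
    refine tendsto_nhds_unique hJ ?_
    have h1 : Tendsto (fun v => (‖D.J v‖ : ℂ) * Complex.exp ((D.J v).arg * Complex.I)) u
        (𝓝 (‖z‖ * Complex.exp (θ * Complex.I))) := by
      refine Tendsto.mul ((Complex.continuous_ofReal.tendsto _).comp hJ.norm) ?_
      exact (Complex.continuous_exp.tendsto _).comp
        (((Complex.continuous_ofReal.tendsto _).comp ht').mul_const _)
    exact h1.congr fun v => Complex.norm_mul_exp_arg_mul_I _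
  refine ⟨θ, ht', ?_, hz'⟩
  by_contra hne
  have hlt : |θ| < π / D.r := lt_of_le_of_ne (abs_le.2 hθ) hne
  have hπ : π / D.r ≤ π := div_le_self Real.pi_pos.le D.hr
  have hθ2 := abs_lt.1 (hlt.trans_le hπ)
  have harg : z.arg = θ := by
    rw [hz', Complex.exp_mul_I]
    exact Complex.arg_mul_cos_add_sin_mul_I (norm_pos_iff.2 hz) ⟨hθ2.1, hθ2.2.le⟩
  apply hzs
  refine ⟨Complex.mem_slitPlane_iff_arg.2 ⟨by rw [harg]; exact hθ2.2.ne, hz⟩, ?_⟩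
  rw [harg, mul_comm, ← lt_div_iff₀ hr]
  exact hlt

theorem tendsto_cpow_of_tendsto_arg {u : Filter ℂ} {z : ℂ} (hz : z ≠ 0)
    (hJ : Tendsto D.J u (𝓝 z)) {θ : ℝ} (hθ : Tendsto (fun v => (D.J v).arg) u (𝓝 θ)) (c : ℂ) :
    Tendsto (fun v => D.J v ^ c) u (𝓝 (Complex.exp ((Real.log ‖z‖ + θ * Complex.I) * c))) := by
  have h1 : Tendsto (fun v => Complex.exp (((Real.log ‖D.J v‖ : ℝ) + (D.J v).arg * Complex.I) * c)) u
      (𝓝 (Complex.exp ((Real.log ‖z‖ + θ * Complex.I) * c))) := by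
    refine (Complex.continuous_exp.tendsto _).comp (Tendsto.mul_const _ (Tendsto.add ?_ ?_))
    · exact (Complex.continuous_ofReal.tendsto _).comp (hJ.norm.log (norm_ne_zero_iff.2 hz))
    · exact ((Complex.continuous_ofReal.tendsto _).comp hθ).mul_const _
  refine h1.congr' ?_
  filter_upwards [hJ.eventually_ne hz] with v hv
  rw [Complex.cpow_def_of_ne_zero hv]
  rfl

theorem exp_mul_r_of_abs_eq {t θ : ℝ} (hθ : |θ| = π / D.r) :
    Complex.exp ((t + θ * Complex.I) * D.r) = ((-Real.exp (t * D.r) : ℝ) : ℂ) := by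
  have hr := D.r_ne
  have hr' := D.r_pos.ne'
  have h1 : Complex.exp (θ * D.r * Complex.I) = -1 := by
    rcases abs_choice θ with h | h
    · have : θ * D.r = π := by rw [← h, hθ]; field_simp
      rw [← Complex.ofReal_mul, this, Complex.exp_pi_mul_I]
    · have : θ * D.r = -π := by
        have : θ = -(π / D.r) := by linarith
        rw [this]; field_simp
      rw [← Complex.ofReal_mul, this, Complex.ofReal_neg, neg_mul, Complex.exp_neg,
        Complex.exp_pi_mul_I]
      norm_num
  rw [show (t + θ * Complex.I) * D.r = ((t * D.r : ℝ) : ℂ) + θ * D.r * Complex.I by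
    push_cast; ring, Complex.exp_add, h1, ← Complex.ofReal_exp]
  push_cast; ring

/-- The `r`-th power sends both boundary rays to the negative axis, which is off the support and
where `G` is real. -/
theorem exists_tendsto_G {u : Filter ℂ} {z : ℂ} (hz : z ≠ 0)
    (hJ : Tendsto D.J u (𝓝 z)) {θ : ℝ} (hθ : Tendsto (fun v => (D.J v).arg) u (𝓝 θ))
    (hθr : |θ| = π / D.r) :
    ∃ c : ℝ, Tendsto (fun v => D.G (D.J v ^ (D.r : ℂ))) u (𝓝 c) := by
  have h1 := D.tendsto_cpow_of_tendsto_arg hz hJ hθ D.r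
  rw [D.exp_mul_r_of_abs_eq hθr] at h1
  set x : ℝ := -Real.exp (Real.log ‖z‖ * D.r)
  have hx : x ≤ 0 := by have := Real.exp_pos (Real.log ‖z‖ * D.r); simp only [x]; linarith
  refine ⟨(D.G x).re, ?_⟩
  have h2 : (((D.G x).re : ℝ) : ℂ) = D.G x := Complex.ext (by simp) (by simp [D.im_G_ofReal x])
  rw [h2]
  exact (D.continuousAt_G (D.ofReal_mem_offSupport hx)).tendsto.comp h1

/-- The boundary values of the continued Cauchy transform on the lower side of the boundary ray
have nonnegative imaginary part. -/
theorem im_inv_sub_mul_exp_nonneg {v : ℂ} (hv : v.im ≤ 0) (hv1 : 1 < ‖v‖)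
    (hJ : D.J v ≠ 0) (hJv : D.J v = ‖D.J v‖ * Complex.exp (-(π / D.r : ℝ) * Complex.I)) {l : ℝ}
    (hl0 : 0 ≤ l) (hl1 : l ≤ 1) :
    0 ≤ ((v⁻¹ - v) * Complex.exp ((l * (π / D.r) : ℝ) * Complex.I)).im := by
  set φ := π / D.r with hφ
  have hφ0 : 0 < φ := div_pos Real.pi_pos D.r_pos
  have hφπ : φ ≤ π := div_le_self Real.pi_pos.le D.hr
  have hρ := D.ρ_pos
  set m := (D.a + D.b) / 2 with hm
  have hmρ : D.ρ < m := by simp only [hm, ρ]; linarith [D.ha]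
  set n := Complex.normSq v with hn
  have hn1 : 1 < n := by rw [hn, Complex.normSq_eq_norm_sq]; nlinarith
  have hn0 : 0 < n := by linarith
  have hnxy : n = v.re * v.re + v.im * v.im := Complex.normSq_apply v
  have hni : 0 < n⁻¹ := inv_pos.2 hn0
  have hTre : (v⁻¹ - v).re = v.re * n⁻¹ - v.re := by
    rw [Complex.sub_re, Complex.inv_re]; ring
  have hTim : (v⁻¹ - v).im = -v.im * (1 + n⁻¹) := by
    rw [Complex.sub_im, Complex.inv_im]; ring
  have hJre := D.J_re v
  have hJim := D.J_im v
  rw [← hn] at hJre hJim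
  rw [← hm] at hJre
  have hTim0 : 0 ≤ (v⁻¹ - v).im := by rw [hTim]; nlinarith
  have hexp : ∀ t : ℝ, Complex.exp (t * Complex.I) = ⟨Real.cos t, Real.sin t⟩ := by
    intro t
    rw [Complex.exp_mul_I]
    apply Complex.ext <;> simp [← Complex.ofReal_cos, ← Complex.ofReal_sin]
  rw [← Complex.ofReal_neg, hexp] at hJv
  rw [hexp, Complex.mul_im]
  have hJr : 0 < ‖D.J v‖ := norm_pos_iff.2 hJ
  have hJre' : (D.J v).re = ‖D.J v‖ * Real.cos φ := by
    conv_lhs => rw [hJv]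
    rw [Complex.re_ofReal_mul, Real.cos_neg]
  have hJim' : (D.J v).im = -(‖D.J v‖ * Real.sin φ) := by
    conv_lhs => rw [hJv]
    rw [Complex.im_ofReal_mul, Real.sin_neg]; ring
  rcases hφπ.lt_or_eq with hlt | heq
  · have hsin : 0 < Real.sin φ := Real.sin_pos_of_pos_of_lt_pi hφ0 hlt
    have hA : 0 ≤ Real.sin ((1 - l) * φ) :=
      Real.sin_nonneg_of_nonneg_of_le_pi (mul_nonneg (by linarith) hφ0.le) (by nlinarith)
    have hB : 0 ≤ Real.sin (l * φ) :=
      Real.sin_nonneg_of_nonneg_of_le_pi (mul_nonneg hl0 hφ0.le) (by nlinarith)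
    -- The extreme case `l = 1`. Since `J v` has argument `-φ`, this quantity times `‖J v‖` is the
    -- imaginary part of `(v⁻¹ - v)` times the conjugate of `J v`. It is nonnegative because `ρ <
    -- m`, that is, `0 < a`.
    have hTe : 0 ≤ (v⁻¹ - v).re * Real.sin φ + (v⁻¹ - v).im * Real.cos φ := by
      have h1 : ‖D.J v‖ * ((v⁻¹ - v).re * Real.sin φ + (v⁻¹ - v).im * Real.cos φ) =
          -v.im * n⁻¹ * (m * (n + 1) + 2 * D.ρ * v.re) := by
        have : ‖D.J v‖ * ((v⁻¹ - v).re * Real.sin φ + (v⁻¹ - v).im * Real.cos φ) =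
          (v⁻¹ - v).re * (-(D.J v).im) + (v⁻¹ - v).im * (D.J v).re := by
          rw [hJre', hJim']; ring
        rw [this, hTre, hTim, hJre, hJim]
        field_simp
        ring
      have h2 : 0 ≤ m * (n + 1) + 2 * D.ρ * v.re := by
        nlinarith [sq_nonneg (v.re + 1), mul_self_nonneg v.im]
      have h3 : 0 ≤ ‖D.J v‖ * ((v⁻¹ - v).re * Real.sin φ + (v⁻¹ - v).im * Real.cos φ) := by
        rw [h1]
        exact mul_nonneg (mul_nonneg (by linarith) hni.le) h2
      exact nonneg_of_mul_nonneg_right h3 hJr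
    have hs : Real.sin ((1 - l) * φ) =
        Real.sin φ * Real.cos (l * φ) - Real.cos φ * Real.sin (l * φ) := by
      rw [show (1 - l) * φ = φ - l * φ by ring, Real.sin_sub]
    -- Interpolation between `l = 0` and `l = 1` with weights that are nonnegative for `l ∈ [0, 1]`.
    have key : Real.sin φ * ((v⁻¹ - v).re * Real.sin (l * φ) + (v⁻¹ - v).im * Real.cos (l * φ)) =
        Real.sin ((1 - l) * φ) * (v⁻¹ - v).im +
        Real.sin (l * φ) * ((v⁻¹ - v).re * Real.sin φ + (v⁻¹ - v).im * Real.cos φ) := by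
      rw [hs]; ring
    refine nonneg_of_mul_nonneg_right (a := Real.sin φ) ?_ hsin
    rw [key]
    positivity
  -- For `r = 1` one has `sin φ = 0` and the interpolation is void; here `v` is real and negative.
  · rw [heq] at hJre' hJim' ⊢
    rw [Real.sin_pi] at hJim'
    rw [Real.cos_pi] at hJre'
    have hy : v.im = 0 := by
      rw [hJim] at hJim'
      have h1 : 1 - n⁻¹ ≠ 0 := by
        have := inv_lt_one_of_one_lt₀ hn1
        linarith
      simpa [hρ.ne', h1] using hJim'
    have hx : v.re < 0 := by
      by_contra! hx
      have : 0 ≤ D.ρ * v.re * (1 + n⁻¹) / 2 := by positivity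
      linarith
    rw [hTim, hTre, hy]
    have h1 : 0 ≤ v.re * n⁻¹ - v.re := by
      have := inv_lt_one_of_one_lt₀ hn1
      nlinarith
    have hB : 0 ≤ Real.sin (l * π) :=
      Real.sin_nonneg_of_nonneg_of_le_pi (mul_nonneg hl0 Real.pi_pos.le)
        (by nlinarith [Real.pi_pos])
    simpa using mul_nonneg h1 hB

/-- On the ray the exponent `-(l k + r)` contributes the phase `l k * π / r + π`. The half-turn
changes `v - v⁻¹` into `v⁻¹ - v`, so the previous inequality applies termwise with positive weights.
-/
theorem im_sub_inv_mul_sum_nonneg {v : ℂ} (hv : v.im ≤ 0) (hv1 : 1 < ‖v‖)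
    (hJ : D.J v ≠ 0) (hJv : D.J v = ‖D.J v‖ * Complex.exp (-(π / D.r : ℝ) * Complex.I)) (t : ℝ) :
    0 ≤ ((v - v⁻¹) * ((D.r : ℂ)⁻¹ * ∑ k, (D.α k : ℂ) *
      Complex.exp ((t + (-(π / D.r) : ℝ) * Complex.I) * (-(D.l k + D.r : ℝ) : ℂ)))).im := by
  have hk : ∀ k, Complex.exp ((t + (-(π / D.r) : ℝ) * Complex.I) * (-(D.l k + D.r : ℝ) : ℂ)) =
      -((Real.exp (-t * (D.l k + D.r)) : ℝ) : ℂ) *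
        Complex.exp ((D.l k * (π / D.r) : ℝ) * Complex.I) := by
    intro k
    have hr := D.r_ne
    rw [show (t + (-(π / D.r) : ℝ) * Complex.I) * (-(D.l k + D.r : ℝ) : ℂ) =
      ((-t * (D.l k + D.r) : ℝ) : ℂ) + ((D.l k * (π / D.r) : ℝ) * Complex.I + π * Complex.I) by
        push_cast; field_simp; ring, Complex.exp_add, Complex.exp_add, Complex.exp_pi_mul_I,
        Complex.ofReal_exp]
    ring
  simp_rw [hk]
  have e : (v - v⁻¹) * ((D.r : ℂ)⁻¹ * ∑ k, (D.α k : ℂ) *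
      (-((Real.exp (-t * (D.l k + D.r)) : ℝ) : ℂ) *
        Complex.exp ((D.l k * (π / D.r) : ℝ) * Complex.I))) =
      ∑ k, ((D.r⁻¹ * D.α k * Real.exp (-t * (D.l k + D.r)) : ℝ) : ℂ) *
        ((v⁻¹ - v) * Complex.exp ((D.l k * (π / D.r) : ℝ) * Complex.I)) := by
    rw [Finset.mul_sum, Finset.mul_sum]
    refine Finset.sum_congr rfl fun k _ => ?_
    push_cast; ring
  rw [e, Complex.im_sum]
  refine Finset.sum_nonneg fun k _ => ?_
  rw [Complex.im_ofReal_mul]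
  refine mul_nonneg ?_ (D.im_inv_sub_mul_exp_nonneg hv hv1 hJ hJv (D.hl0 k) (D.hl1 k))
  have := D.hα k
  have := D.r_pos
  positivity

theorem im_Gt_eq_zero {v : ℂ} (hv : v.im = 0) (hJ : D.J v ∈ D.sector) : (D.Gt v).im = 0 := by
  have h1 : (D.J v).im = 0 := by rw [J_im, hv]; ring
  have h2 : D.J v = (((D.J v).re : ℝ) : ℂ) := Complex.ext (by simp) (by simp [h1])
  have h3 : 0 < (D.J v).re := by
    have := hJ.1
    rw [h2] at this
    exact Complex.ofReal_mem_slitPlane.1 this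
  have h4 : v = ((v.re : ℝ) : ℂ) := Complex.ext (by simp) (by simp [hv])
  rw [Gt, h2, Complex.add_im, D.im_R_ofReal h3]
  have h5 : D.q ((D.J v).re : ℂ) = (((D.q ((D.J v).re : ℂ)).re : ℝ) : ℂ) :=
    Complex.ext (by simp) (by simp [D.im_q_ofReal h3])
  rw [h5, h4]
  norm_cast

/-- The behaviour of the continued Cauchy transform along an ultrafilter on its domain. -/
theorem boundary_behaviour (u : Ultrafilter ℂ) (hu : D.V ∈ u) :
    (∃ v ∈ D.V, (u : Filter ℂ) ≤ 𝓝 v) ∨ (∃ w : ℂ, 0 ≤ w.im ∧ Tendsto D.Gt u (𝓝 w)) ∨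
      ((∀ᶠ v in (u : Filter ℂ), 1 < ‖v‖) ∧ Tendsto D.J u (𝓝 0)) := by
  have huV : ∀ᶠ v in (u : Filter ℂ), v ∈ D.V := hu
  rcases ultrafilter_le_cobounded_or_le_nhds (u := u) with hc | ⟨v, huv⟩
  · refine Or.inr (Or.inl ?_)
    obtain ⟨c, hc'⟩ := D.exists_tendsto_sub_inv_mul_q hc
    refine ⟨0 + π * D.ρ * c, ?_, ?_⟩
    · rw [zero_add]; norm_cast
    · have h1 : Tendsto (fun v => D.G (D.J v ^ (D.r : ℂ))) u (𝓝 0) :=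
        D.tendsto_G_cobounded.comp ((tendsto_cpow_cobounded D.r_pos).comp
          (D.tendsto_J_cobounded.mono_left hc))
      refine (h1.add (hc'.const_mul (π * D.ρ : ℂ))).congr' ?_
      filter_upwards [huV, (tendsto_norm_cobounded_atTop.mono_left hc).eventually_gt_atTop 1]
        with v hv hv1
      rw [D.Gt_of_lt_norm hv hv1]; ring
  have him : v.im ≤ 0 := by
    refine le_of_tendsto ((Complex.continuous_im.tendsto v).mono_left huv) ?_
    filter_upwards [huV] with y hy using le_of_lt hy.1
  -- The point `v = 0` corresponds to infinity on the first sheet, where `G` vanishes.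
  by_cases hv0 : v = 0
  · subst hv0
    refine Or.inr (Or.inl ⟨0, le_rfl, ?_⟩)
    have hne : (u : Filter ℂ) ≤ 𝓝[≠] 0 := by
      refine le_inf huv (le_principal_iff.2 ?_)
      filter_upwards [huV] with y hy using ne_zero_of_im_neg hy.1
    have hJ : Tendsto D.J u (Bornology.cobounded ℂ) := by
      refine (D.tendsto_J_cobounded.comp (tendsto_inv₀_nhdsNE_zero.mono_left hne)).congr
        fun y => D.J_inv y
    refine (D.tendsto_G_cobounded.comp ((tendsto_cpow_cobounded D.r_pos).comp hJ)).congr' ?_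
    filter_upwards [huV, eventually_norm_lt huv (by simp)] with y hy hy1
    rw [D.Gt_of_norm_lt hy hy1]; rfl
  have hJ : Tendsto D.J u (𝓝 (D.J v)) :=
    (D.differentiableAt_J hv0).continuousAt.tendsto.mono_left huv
  -- If `J v` is in the sector, then either `v ∈ V` or `v` is real; in the second case `Gt v` is
  -- real.
  by_cases hsec : D.J v ∈ D.sector
  · rcases him.lt_or_eq with hlt | heq
    · exact Or.inl ⟨v, ⟨hlt, hsec.2⟩, huv⟩
    · exact Or.inr (Or.inl ⟨D.Gt v, (D.im_Gt_eq_zero heq hsec).ge,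
        (D.differentiableAt_Gt hv0 hsec).continuousAt.tendsto.mono_left huv⟩)
  have hv1 : ‖v‖ ≠ 1 := by
    intro h
    obtain ⟨x, hx, hxv⟩ := D.J_mem_Icc h
    exact hsec (hxv ▸ D.ofReal_mem_sector (D.ha.trans_le hx.1))
  -- Inside the disc `J v → 0` is harmless, since `0` is off the support; outside the disc it is the
  -- exceptional case.
  by_cases hz : D.J v = 0
  · rcases lt_or_gt_of_ne hv1 with h1 | h1
    · refine Or.inr (Or.inl ⟨D.G (0 : ℝ), (D.im_G_ofReal 0).ge, ?_⟩)
      have h2 : Tendsto (fun y => D.J y ^ (D.r : ℂ)) u (𝓝 ((0 : ℝ) : ℂ)) := by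
        rw [Complex.ofReal_zero]
        exact (tendsto_cpow_zero D.r_pos).comp (hz ▸ hJ)
      refine ((D.continuousAt_G (D.ofReal_mem_offSupport le_rfl)).tendsto.comp h2).congr' ?_
      filter_upwards [huV, eventually_norm_lt huv h1] with y hy hy1
      rw [D.Gt_of_norm_lt hy hy1]; rfl
    · exact Or.inr (Or.inr ⟨eventually_lt_norm huv h1, hz ▸ hJ⟩)
  refine Or.inr (Or.inl ?_)
  obtain ⟨θ, hθ, hθr, hzθ⟩ := D.exists_tendsto_arg hu hz hJ hsec
  obtain ⟨c, hc⟩ := D.exists_tendsto_G hz hJ hθ hθr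
  rcases lt_or_gt_of_ne hv1 with h1 | h1
  · refine ⟨c, by simp, hc.congr' ?_⟩
    filter_upwards [huV, eventually_norm_lt huv h1] with y hy hy1
    rw [D.Gt_of_norm_lt hy hy1]
  -- Outside the disc `J` takes values in the lower half-plane, so only the lower ray occurs.
  · have hθneg : θ = -(π / D.r) := by
      have h2 : θ ≤ 0 := by
        refine le_of_tendsto hθ ?_
        filter_upwards [huV, eventually_lt_norm huv h1] with y hy hy1
        exact (Complex.arg_neg_iff.2 (D.im_J_neg hy.1 hy1)).le
      rw [abs_of_nonpos h2] at hθr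
      linarith
    set L := (Real.log ‖D.J v‖ : ℝ)
    have hq : Tendsto (fun y => D.q (D.J y)) u (𝓝 ((D.r : ℂ)⁻¹ * ∑ k, (D.α k : ℂ) *
        Complex.exp ((L + θ * Complex.I) * (-(D.l k + D.r : ℝ) : ℂ)))) := by
      refine Tendsto.const_mul _ (tendsto_finsetSum _ fun k _ => Tendsto.const_mul _ ?_)
      exact D.tendsto_cpow_of_tendsto_arg hz hJ hθ _
    have hsub : Tendsto (fun y : ℂ => y - y⁻¹) u (𝓝 (v - v⁻¹)) :=
      (tendsto_id'.2 huv).sub ((tendsto_inv₀ hv0).mono_left huv)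
    refine ⟨c + ((π * D.ρ : ℝ) : ℂ) * ((v - v⁻¹) * ((D.r : ℂ)⁻¹ * ∑ k, (D.α k : ℂ) *
        Complex.exp ((L + θ * Complex.I) * (-(D.l k + D.r : ℝ) : ℂ)))), ?_, ?_⟩
    · rw [Complex.add_im, Complex.ofReal_im, zero_add, Complex.im_ofReal_mul]
      refine mul_nonneg (mul_nonneg Real.pi_pos.le D.ρ_pos.le) ?_
      rw [hθneg]
      rw [hθneg, Complex.ofReal_neg] at hzθ
      exact D.im_sub_inv_mul_sum_nonneg him h1 hz hzθ L
    · refine (hc.add ((hsub.mul hq).const_mul _)).congr' ?_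
      filter_upwards [huV, eventually_lt_norm huv h1] with y hy hy1
      rw [D.Gt_of_lt_norm hy hy1]; push_cast; ring

end PowerData

/-! ### The singularity at `0` and the degree. -/

theorem tendsto_exp_neg_mul_comap_re {c : ℝ} (hc : 0 < c) :
    Tendsto (fun σ : ℂ => Complex.exp (-(c : ℂ) * σ)) (comap Complex.re atTop) (𝓝 0) := by
  rw [tendsto_zero_iff_norm_tendsto_zero]
  simp_rw [Complex.norm_exp]
  have h : ∀ σ : ℂ, (-(c : ℂ) * σ).re = -(c * σ.re) := by
    intro σ; rw [neg_mul, Complex.neg_re, Complex.re_ofReal_mul]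
  simp_rw [h]
  exact Real.tendsto_exp_neg_atTop_nhds_zero.comp
    ((tendsto_id.const_mul_atTop hc).comp tendsto_comap)

/-- If `Λ` has derivative at most `1 / 2` on a half plane, then `σ ↦ c σ + Λ σ` is injective there
for `c ≥ 1`. -/
theorem injOn_mul_add_of_norm_deriv_le {Λ : ℂ → ℂ} {Y c : ℝ} (hc : 1 ≤ c)
    (hd : DifferentiableOn ℂ Λ {σ | Y < σ.re}) (hΛ : ∀ σ : ℂ, Y < σ.re → ‖deriv Λ σ‖ ≤ 1 / 2) :
    InjOn (fun σ => (c : ℂ) * σ + Λ σ) {σ | Y < σ.re} := by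
  intro σ hσ σ' hσ' h
  have ho : IsOpen {σ : ℂ | Y < σ.re} := isOpen_lt continuous_const Complex.continuous_re
  have h1 := (convex_halfSpace_re_gt Y).norm_image_sub_le_of_norm_deriv_le
    (fun x hx => hd.differentiableAt (ho.mem_nhds hx)) (fun x hx => hΛ x hx) hσ hσ'
  have h2 : (c : ℂ) * (σ' - σ) = -(Λ σ' - Λ σ) := by
    simp only at h; linear_combination -h
  have h3 : c * ‖σ' - σ‖ = ‖Λ σ' - Λ σ‖ := by
    have := congrArg norm h2
    rwa [norm_mul, norm_neg, Complex.norm_real, Real.norm_of_nonneg (by linarith)] at this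
  have h4 := norm_nonneg (σ' - σ)
  have h5 : ‖σ' - σ‖ = 0 := by nlinarith
  exact (sub_eq_zero.1 (norm_eq_zero.1 h5)).symm

/-- Of the possible imaginary parts `π / 2 + 2πn` only `π / 2` lies in the window, even with the
margin `1 / 2` at both ends. -/
theorem eq_log_of_exp_eq_mul_I {M : ℂ} {t : ℝ} (ht : 0 < t) (h : Complex.exp M = t * Complex.I)
    (h1 : -(1 / 2) ≤ M.im) (h2 : M.im ≤ 2 * π + 1 / 2) : M = Complex.log (t * Complex.I) := by
  have h0 : (t : ℂ) * Complex.I ≠ 0 := by simp [ht.ne']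
  rw [← Complex.exp_log h0] at h
  obtain ⟨n, hn⟩ := Complex.exp_eq_exp_iff_exists_int.1 h
  have him : (Complex.log (t * Complex.I)).im = π / 2 := by
    rw [Complex.log_im, Complex.arg_real_mul _ ht, Complex.arg_I]
  have e : M.im = π / 2 + n * (2 * π) := by
    rw [hn, Complex.add_im, him,
      show (n : ℂ) * (2 * π * Complex.I) = ((n * (2 * π) : ℝ) : ℂ) * Complex.I by push_cast; ring,
      Complex.im_ofReal_mul, Complex.I_im, mul_one]
  have hπ := Real.pi_gt_three
  have hn0 : n = 0 := by
    have h3 : (-1 : ℝ) < n := by nlinarith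
    have h4 : (n : ℝ) < 1 := by nlinarith
    have h5 : (-1 : ℤ) < n := by exact_mod_cast h3
    have h6 : n < (1 : ℤ) := by exact_mod_cast h4
    omega
  rw [hn, hn0]; simp

namespace PowerData

variable {N : ℕ} (D : PowerData N)

theorem exists_max_l : ∃ k, ∀ j, D.l j ≤ D.l k := by
  have hN : N ≠ 0 := by
    rintro rfl
    -- For `N = 0` the density would be `0`, against total mass `1`.
    have := D.mass
    simp at this
  have : Nonempty (Fin N) := ⟨⟨0, Nat.pos_of_ne_zero hN⟩⟩
  exact Finite.exists_max D.l

/-- The continued Cauchy transform near the singularity at `0`, up to a power factor. -/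
noncomputable def Ψ (k : Fin N) (σ : ℂ) : ℂ :=
  2 * π * (D.r : ℂ)⁻¹ * ((D.a - Complex.exp (-σ)) * (D.b - Complex.exp (-σ))) ^ (1 / 2 : ℂ) *
    ∑ j, (D.α j : ℂ) * Complex.exp (-((D.l k - D.l j : ℝ) : ℂ) * σ) -
  Complex.exp (-((D.l k + D.r : ℝ) : ℂ) * σ) * D.G (Complex.exp (-(D.r : ℂ) * σ))

theorem re_sub_mul_sub_pos {z : ℂ} (hz : ‖z‖ < D.a / 4) :
    0 < ((D.a - z) * (D.b - z)).re := by
  have h1 : ((D.a - z) * (D.b - z)).re = D.a * D.b - (D.a + D.b) * z.re + (z ^ 2).re := by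
    rw [show (D.a - z) * (D.b - z) =
      ((D.a * D.b : ℝ) : ℂ) - ((D.a + D.b : ℝ) : ℂ) * z + z ^ 2 by push_cast; ring,
      Complex.add_re, Complex.sub_re, Complex.ofReal_re, Complex.re_ofReal_mul]
  have h2 := (abs_le.1 (Complex.abs_re_le_norm z)).2
  have h3 := (abs_le.1 (Complex.abs_re_le_norm (z ^ 2))).1
  rw [norm_pow] at h3
  have h4 := norm_nonneg z
  have ha := D.ha
  have hab := D.hab
  rw [h1]
  nlinarith [mul_pos ha D.b_pos]

theorem norm_exp_neg_lt {σ : ℂ} (hσ : -Real.log (D.a / 4) < σ.re) :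
    ‖Complex.exp (-σ)‖ < D.a / 4 := by
  rw [Complex.norm_exp, Complex.neg_re, ← Real.lt_log_iff_exp_lt (by linarith [D.ha])]
  linarith

theorem exp_mem_offSupport {σ : ℂ} (hσ : -Real.log (D.a / 4) < σ.re) :
    Complex.exp (-(D.r : ℂ) * σ) ∈ D.offSupport := by
  intro x hx h
  have hx0 := D.ha.trans_le hx.1
  have h1 := congrArg norm h
  rw [Complex.norm_real, Real.norm_of_nonneg (Real.rpow_nonneg hx0.le _), Complex.norm_exp,
    neg_mul, Complex.neg_re, Complex.re_ofReal_mul, Real.rpow_def_of_pos hx0] at h1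
  have h2 := Real.exp_injective h1
  have h3 : Real.log (D.a / 4) ≤ Real.log x :=
    Real.log_le_log (by linarith [D.ha]) (by linarith [D.ha, hx.1])
  nlinarith [D.r_pos]

theorem differentiableOn_Ψ (k : Fin N) :
    DifferentiableOn ℂ (D.Ψ k) {σ | -Real.log (D.a / 4) < σ.re} := by
  intro σ hσ
  refine DifferentiableAt.differentiableWithinAt ?_
  unfold Ψ
  have h1 : DifferentiableAt ℂ D.G (Complex.exp (-(D.r : ℂ) * σ)) :=
    D.differentiableOn_G.differentiableAt (D.isOpen_offSupport.mem_nhds (D.exp_mem_offSupport hσ))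
  have h2 : DifferentiableAt ℂ (fun σ => D.G (Complex.exp (-(D.r : ℂ) * σ))) σ :=
    h1.comp (f := fun σ => Complex.exp (-(D.r : ℂ) * σ)) σ (by fun_prop)
  have h3 : DifferentiableAt ℂ (fun σ : ℂ =>
      ((D.a - Complex.exp (-σ)) * (D.b - Complex.exp (-σ))) ^ (1 / 2 : ℂ)) σ := by
    refine DifferentiableAt.cpow (by fun_prop) (by fun_prop) (Or.inl ?_)
    exact D.re_sub_mul_sub_pos (D.norm_exp_neg_lt hσ)
  exact ((h3.const_mul _).mul (by fun_prop)).sub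
    (DifferentiableAt.mul (by fun_prop) h2)

/-- The leading coefficient at the singularity at `0`. -/
noncomputable def leadCoeff (k : Fin N) : ℝ := 2 * π * D.r⁻¹ * (D.a * D.b) ^ (1 / 2 : ℝ) * D.α k

theorem leadCoeff_pos (k : Fin N) : 0 < D.leadCoeff k := by
  have := D.hα k
  have := D.r_pos
  have := D.ha
  have := D.b_pos
  unfold leadCoeff
  positivity

/-- Only the term with the largest exponent survives, and it is unique by injectivity of `l`. The
term with `G` decays because `G` is continuous at `0`. -/
theorem tendsto_Ψ {k : Fin N} (hk : ∀ j, D.l j ≤ D.l k) :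
    Tendsto (D.Ψ k) (comap Complex.re atTop) (𝓝 (D.leadCoeff k)) := by
  have hexp : Tendsto (fun σ : ℂ => Complex.exp (-σ)) (comap Complex.re atTop) (𝓝 0) := by
    simpa using tendsto_exp_neg_mul_comap_re one_pos
  have h1 : Tendsto (fun σ : ℂ =>
      ((D.a - Complex.exp (-σ)) * (D.b - Complex.exp (-σ))) ^ (1 / 2 : ℂ))
      (comap Complex.re atTop) (𝓝 (((D.a - 0) * (D.b - 0)) ^ (1 / 2 : ℂ))) := by
    refine Tendsto.cpow ((hexp.const_sub _).mul (hexp.const_sub _)) tendsto_const_nhds (Or.inl ?_)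
    rw [sub_zero, sub_zero, ← Complex.ofReal_mul, Complex.ofReal_re]
    exact mul_pos D.ha D.b_pos
  have h2 : Tendsto (fun σ : ℂ => ∑ j, (D.α j : ℂ) *
      Complex.exp (-((D.l k - D.l j : ℝ) : ℂ) * σ)) (comap Complex.re atTop)
      (𝓝 (∑ j, if j = k then (D.α k : ℂ) else 0)) := by
    refine tendsto_finsetSum _ fun j _ => ?_
    split_ifs with h
    · subst h; simpa using tendsto_const_nhds
    · have : 0 < D.l k - D.l j :=
        sub_pos.2 (lt_of_le_of_ne (hk j) fun e => h (D.hl e))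
      simpa using (tendsto_exp_neg_mul_comap_re this).const_mul (D.α j : ℂ)
  rw [Finset.sum_ite_eq' Finset.univ k, if_pos (Finset.mem_univ k)] at h2
  have h3 : Tendsto (fun σ : ℂ => D.G (Complex.exp (-(D.r : ℂ) * σ)))
      (comap Complex.re atTop) (𝓝 (D.G (0 : ℝ))) := by
    have h0 := tendsto_exp_neg_mul_comap_re D.r_pos
    rw [← Complex.ofReal_zero] at h0
    exact (D.continuousAt_G (D.ofReal_mem_offSupport le_rfl)).tendsto.comp h0
  have h4 := tendsto_exp_neg_mul_comap_re (c := D.l k + D.r) (by linarith [D.hl0 k, D.r_pos])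
  have h5 := ((h1.const_mul (2 * π * (D.r : ℂ)⁻¹)).mul h2).sub (h4.mul h3)
  have e : ((D.leadCoeff k : ℝ) : ℂ) = 2 * π * (D.r : ℂ)⁻¹ * ((D.a - 0) * (D.b - 0)) ^ (1 / 2 : ℂ) *
      D.α k - 0 * D.G (0 : ℝ) := by
    rw [leadCoeff, sub_zero, sub_zero, zero_mul, sub_zero, ← Complex.ofReal_mul D.a D.b]
    push_cast
    rw [← Complex.ofReal_mul, Complex.ofReal_cpow (mul_pos D.ha D.b_pos).le]
    push_cast
    rfl
  rw [e]
  exact h5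

/-- Both sides have the same square. The sign is fixed by real parts: near `J v = 0` one has `v.re <
0`, and `|v| > 1` makes the real part on the left negative, while the principal root has positive
real part. -/
theorem ρ_mul_sub_inv {v : ℂ} (hv : v.im < 0) (hv1 : 1 < ‖v‖) (hJ : ‖D.J v‖ < D.a / 4) :
    D.ρ * (v - v⁻¹) = -2 * ((D.a - D.J v) * (D.b - D.J v)) ^ (1 / 2 : ℂ) := by
  have hv0 := ne_zero_of_im_neg hv
  have hre := D.re_sub_mul_sub_pos hJ
  set w := (D.a - D.J v) * (D.b - D.J v) with hw
  have hw0 : w ≠ 0 := fun h => by rw [h] at hre; simp at hre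
  have hsq : (w ^ (1 / 2 : ℂ)) ^ 2 = w := by
    rw [← Complex.cpow_nat_mul]; norm_num
  have hsqre : 0 < (w ^ (1 / 2 : ℂ)).re := by
    rw [Complex.cpow_def_of_ne_zero hw0, Complex.exp_re]
    refine mul_pos (Real.exp_pos _) (Real.cos_pos_of_mem_Ioo ?_)
    have h1 : (Complex.log w * (1 / 2)).im = w.arg / 2 := by
      rw [show (1 / 2 : ℂ) = ((1 / 2 : ℝ) : ℂ) by push_cast; rfl, Complex.im_mul_ofReal,
        Complex.log_im]
      ring
    rw [h1]
    have h2 := abs_lt.1 (Complex.abs_arg_lt_pi_div_two_iff.2 (Or.inl hre))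
    constructor <;> linarith [h2.1, h2.2, Real.pi_pos]
  have hn1 : 1 < Complex.normSq v := by rw [Complex.normSq_eq_norm_sq]; nlinarith
  have hni := inv_lt_one_of_one_lt₀ hn1
  have hni0 : 0 < (Complex.normSq v)⁻¹ := inv_pos.2 (by linarith)
  have hx : v.re < 0 := by
    by_contra! hx
    have h1 := (abs_le.1 (Complex.abs_re_le_norm (D.J v))).2
    rw [J_re] at h1
    have : 0 ≤ D.ρ * v.re * (1 + (Complex.normSq v)⁻¹) / 2 := by
      have := D.ρ_pos
      positivity
    linarith [D.ha, D.hab]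
  have hre2 : (D.ρ * (v - v⁻¹)).re < 0 := by
    rw [Complex.re_ofReal_mul, Complex.sub_re, Complex.inv_re]
    have : v.re - v.re / Complex.normSq v = v.re * (1 - (Complex.normSq v)⁻¹) := by ring
    rw [this]
    exact mul_neg_of_pos_of_neg D.ρ_pos (mul_neg_of_neg_of_pos hx (by linarith))
  have hsq2 : (D.ρ * (v - v⁻¹)) ^ 2 = (2 * w ^ (1 / 2 : ℂ)) ^ 2 := by
    rw [mul_pow 2, hsq, hw, J_eq']
    unfold ρ
    push_cast
    field_simp
    ring
  rcases sq_eq_sq_iff_eq_or_eq_neg.1 hsq2 with h | h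
  · exfalso
    rw [h, two_mul, Complex.add_re] at hre2
    linarith
  · rw [h]; ring

theorem Gt_eq_exp_mul_Ψ (k : Fin N) {v : ℂ} (hv : v ∈ D.V) (hv1 : 1 < ‖v‖)
    (hJ : ‖D.J v‖ < D.a / 4) :
    D.Gt v = -(Complex.exp ((D.l k + D.r : ℝ) * -Complex.log (D.J v)) *
      D.Ψ k (-Complex.log (D.J v))) := by
  have hJ0 := D.J_ne_zero hv.1
  have hexp : Complex.exp (- -Complex.log (D.J v)) = D.J v := by
    rw [neg_neg, Complex.exp_log hJ0]
  have hr : Complex.exp (-(D.r : ℂ) * -Complex.log (D.J v)) = D.J v ^ (D.r : ℂ) := by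
    rw [Complex.cpow_def_of_ne_zero hJ0]; ring_nf
  have h1 := D.ρ_mul_sub_inv hv.1 hv1 hJ
  have he : Complex.exp ((D.l k + D.r : ℝ) * -Complex.log (D.J v)) *
      Complex.exp (-((D.l k + D.r : ℝ) : ℂ) * -Complex.log (D.J v)) = 1 := by
    rw [← Complex.exp_add, neg_mul, add_neg_cancel, Complex.exp_zero]
  have h2 : D.q (D.J v) = (D.r : ℂ)⁻¹ *
      (Complex.exp ((D.l k + D.r : ℝ) * -Complex.log (D.J v)) *
      ∑ j, (D.α j : ℂ) * Complex.exp (-((D.l k - D.l j : ℝ) : ℂ) * -Complex.log (D.J v))) := by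
    rw [q, Finset.mul_sum (a := Complex.exp _)]
    congr 1
    refine Finset.sum_congr rfl fun j _ => ?_
    rw [mul_left_comm, ← Complex.exp_add, Complex.cpow_def_of_ne_zero hJ0]
    congr 2
    push_cast; ring
  rw [D.Gt_of_lt_norm hv hv1, mul_assoc (π : ℂ), h1, Ψ, hexp, hr, h2]
  linear_combination (-D.G (D.J v ^ (D.r : ℂ))) * he

/-- Otherwise preimages of `-i(n + 1)` violating the claim give an ultrafilter along which `Gt` is
unbounded; by `boundary_behaviour` it must approach the singularity, where the claim holds. -/
theorem exists_large_value {ε : ℝ} (hε : 0 < ε) : ∃ T : ℝ, 0 < T ∧ ∀ v ∈ D.V,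
    D.Gt v = -(T * Complex.I) → 1 < ‖v‖ ∧ ‖D.J v‖ < ε := by
  by_contra! hcon
  have : ∀ n : ℕ, ∃ v ∈ D.V, D.Gt v = -(((n + 1 : ℝ) : ℂ) * Complex.I) ∧
      ¬ (1 < ‖v‖ ∧ ‖D.J v‖ < ε) := by
    intro n
    obtain ⟨v, hv, h1, h2⟩ := hcon (n + 1) (by positivity)
    exact ⟨v, hv, h1, fun h => absurd (h2 h.1) (not_le.2 h.2)⟩
  choose v hv hG hA using this
  set u : Ultrafilter ℂ := (hyperfilter ℕ).map v with hu
  have hVu : D.V ∈ u := by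
    rw [hu, Ultrafilter.mem_map]
    exact Filter.univ_mem' hv
  have hnot : ∀ w : ℂ, ¬ Tendsto D.Gt u (𝓝 w) := by
    intro w hw
    have h1 : Tendsto (fun n => ‖D.Gt (v n)‖) (hyperfilter ℕ : Filter ℕ) (𝓝 ‖w‖) := by
      rw [hu, Ultrafilter.coe_map, tendsto_map'_iff] at hw
      exact hw.norm
    have h2 : Tendsto (fun n => ‖D.Gt (v n)‖) (hyperfilter ℕ : Filter ℕ) atTop := by
      have h3 : Tendsto (fun n : ℕ => (n : ℝ) + 1) (hyperfilter ℕ : Filter ℕ) atTop :=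
        (tendsto_atTop_add_const_right _ _ tendsto_natCast_atTop_atTop).mono_left
          Nat.hyperfilter_le_atTop
      refine h3.congr fun n => ?_
      rw [hG, norm_neg, norm_mul, Complex.norm_I, mul_one, Complex.norm_real,
        Real.norm_of_nonneg (by positivity)]
    exact not_tendsto_nhds_of_tendsto_atTop h2 _ h1
  rcases D.boundary_behaviour u hVu with ⟨z, hz, huz⟩ | ⟨w, -, hw⟩ | ⟨h1, h2⟩
  · exact hnot _ (((D.differentiableOn_Gt.continuousOn).continuousAt
      (D.isOpen_V.mem_nhds hz)).tendsto.mono_left huz)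
  · exact hnot _ hw
  · have h3 : ∀ᶠ y in (u : Filter ℂ), ‖D.J y‖ < ε := by
      have := h2.norm
      rw [norm_zero] at this
      exact this.eventually (gt_mem_nhds hε)
    have h4 := h1.and h3
    rw [hu, Ultrafilter.coe_map, eventually_map] at h4
    obtain ⟨n, hn⟩ := h4.exists
    exact hA n hn

theorem hasDerivAt_J {v : ℂ} (hv : v ≠ 0) :
    HasDerivAt D.J (((D.ρ / 2 : ℝ) : ℂ) * (1 + -(v ^ 2)⁻¹)) v := by
  have h : D.J = fun v => (((D.a + D.b) / 2 : ℝ) : ℂ) + ((D.ρ / 2 : ℝ) : ℂ) * (v + v⁻¹) :=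
    funext D.J_eq'
  rw [h]
  exact (((hasDerivAt_id v).add (hasDerivAt_inv hv)).const_mul _).const_add _

/-- With `σ = -log (J v)`, near the singularity `Gt v = -C exp (c σ + Λ σ)` with `Λ` and its
derivative small. For the value `-iT` the exponent is determined by the size of its imaginary part,
and `σ ↦ c σ + Λ σ` is injective. -/
theorem exists_unique_noncritical_value : ∃ w ∈ lowerHalfPlane, ∀ v ∈ D.V, D.Gt v = w →
    deriv D.Gt v ≠ 0 ∧ ∀ v' ∈ D.V, D.Gt v' = w → v = v' := by
  obtain ⟨k, hk⟩ := D.exists_max_l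
  set c : ℝ := D.l k + D.r with hc
  have hc1 : 1 ≤ c := by linarith [D.hl0 k, D.hr]
  set C : ℝ := D.leadCoeff k with hCdef
  have hC : 0 < C := D.leadCoeff_pos k
  have hC0 : (C : ℂ) ≠ 0 := by exact_mod_cast hC.ne'
  have hlim1 : Tendsto (fun σ => D.Ψ k σ / C) (comap Complex.re atTop) (𝓝 1) := by
    have := (D.tendsto_Ψ hk).div_const (C : ℂ)
    rwa [← hCdef, div_self hC0] at this
  obtain ⟨X, hX, hX'⟩ := exists_norm_deriv_le_of_tendsto_re
    ((D.differentiableOn_Ψ k).div_const (C : ℂ)) hlim1 (ε := 1 / 2) (by norm_num)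
  have hslit : ∀ σ : ℂ, X < σ.re → D.Ψ k σ / C ∈ Complex.slitPlane := by
    intro σ hσ
    left
    have h1 := (abs_le.1 ((Complex.abs_re_le_norm _).trans (hX' σ hσ).1)).1
    rw [Complex.sub_re, Complex.one_re] at h1
    linarith
  set Λ : ℂ → ℂ := fun σ => Complex.log (D.Ψ k σ / C) with hΛ
  have hΛd : DifferentiableOn ℂ Λ {σ | X < σ.re} := by
    refine DifferentiableOn.clog (((D.differentiableOn_Ψ k).div_const (C : ℂ)).mono ?_) hslit
    exact fun σ hσ => hX.trans_lt hσ
  have hΛlim : Tendsto Λ (comap Complex.re atTop) (𝓝 0) := by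
    have := hlim1.clog Complex.one_mem_slitPlane
    rwa [Complex.log_one] at this
  obtain ⟨Y, hY, hY'⟩ := exists_norm_deriv_le_of_tendsto_re hΛd hΛlim (ε := 1 / 2) (by norm_num)
  have hinj := injOn_mul_add_of_norm_deriv_le hc1 (hΛd.mono fun σ hσ => hY.trans_lt hσ)
    fun σ hσ => (hY' σ hσ).2
  obtain ⟨T, hT, hA⟩ := D.exists_large_value (ε := min (Real.exp (-Y)) (D.a / 4))
    (lt_min (Real.exp_pos _) (by linarith [D.ha]))
  set σ : ℂ → ℂ := fun v => -Complex.log (D.J v) with hσ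
  have hσre : ∀ v : ℂ, v.im < 0 → ‖D.J v‖ < min (Real.exp (-Y)) (D.a / 4) → Y < (σ v).re := by
    intro v hv h
    have h1 := h.trans_le (min_le_left _ _)
    rw [← Real.log_lt_iff_lt_exp (norm_pos_iff.2 (D.J_ne_zero hv))] at h1
    simp only [hσ, Complex.neg_re, Complex.log_re]
    linarith
  have hrep : ∀ v ∈ D.V, 1 < ‖v‖ → ‖D.J v‖ < min (Real.exp (-Y)) (D.a / 4) →
      D.Gt v = -(C * Complex.exp (c * σ v + Λ (σ v))) := by
    intro v hv h1 h2
    rw [D.Gt_eq_exp_mul_Ψ k hv h1 (h2.trans_le (min_le_right _ _)), Complex.exp_add, hΛ,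
      Complex.exp_log (Complex.slitPlane_ne_zero
        (hslit _ (hY.trans_lt (hσre v hv.1 h2)))), mul_left_comm, mul_div_cancel₀ _ hC0]
  have hM : ∀ v ∈ D.V, D.Gt v = -(T * Complex.I) →
      c * σ v + Λ (σ v) = Complex.log (((T / C : ℝ) : ℂ) * Complex.I) := by
    intro v hv hG
    obtain ⟨h1, h2⟩ := hA v hv hG
    have h3 := hrep v hv h1 h2
    rw [hG, neg_inj] at h3
    have hΛb : |(Λ (σ v)).im| ≤ 1 / 2 := by
      have := (hY' _ (hσre v hv.1 h2)).1
      rw [sub_zero] at this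
      exact (Complex.abs_im_le_norm _).trans this
    have him : (c * σ v + Λ (σ v)).im = c * -(D.J v).arg + (Λ (σ v)).im := by
      rw [Complex.add_im, Complex.im_ofReal_mul, hσ, Complex.neg_im, Complex.log_im]
    have harg : (D.J v).arg < 0 := Complex.arg_neg_iff.2 (D.im_J_neg hv.1 h1)
    have harg2 := hv.2
    rw [abs_of_neg harg] at harg2
    -- Since `-π / r < arg (J v) < 0`, this keeps `-c * arg (J v)` in `(0, 2π)`; it uses `l k ≤ 1 ≤
    -- r`.
    have hcr : c ≤ 2 * D.r := by linarith [D.hl1 k, D.hr]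
    refine eq_log_of_exp_eq_mul_I (div_pos hT hC) ?_ ?_ ?_
    · push_cast
      field_simp
      rw [h3, mul_comm]
    · rw [him]
      nlinarith [(abs_le.1 hΛb).1]
    · rw [him]
      nlinarith [(abs_le.1 hΛb).2]
  refine ⟨-(T * Complex.I), by simpa [lowerHalfPlane] using hT, fun v hv hG => ⟨?_, ?_⟩⟩
  · obtain ⟨h1, h2⟩ := hA v hv hG
    have hv0 := ne_zero_of_im_neg hv.1
    have hJd := D.hasDerivAt_J hv0
    have hnear : D.Gt =ᶠ[𝓝 v] fun y => -(C * Complex.exp (c * σ y + Λ (σ y))) := by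
      filter_upwards [D.isOpen_V.mem_nhds hv, eventually_lt_norm le_rfl h1,
        (hJd.continuousAt.norm).eventually (gt_mem_nhds h2)] with y hy hy1 hy2
      exact hrep y hy hy1 hy2
    have hσd : HasDerivAt σ (-((((D.ρ / 2 : ℝ) : ℂ) * (1 + -(v ^ 2)⁻¹)) / D.J v)) v :=
      (hJd.clog (D.J_mem_sector hv).1).neg
    have hYσ := hσre v hv.1 h2
    have hΛd' : HasDerivAt Λ (deriv Λ (σ v)) (σ v) :=
      (hΛd.differentiableAt ((isOpen_lt continuous_const Complex.continuous_re).mem_nhds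
        (hY.trans_lt hYσ))).hasDerivAt
    have hMd := ((((hasDerivAt_id (σ v)).const_mul (c : ℂ)).add hΛd').comp v hσd).cexp.const_mul
      (C : ℂ) |>.neg
    have hG' := (hMd.congr_of_eventuallyEq (f₁ := D.Gt) hnear).deriv
    rw [hG']
    refine neg_ne_zero.2 (mul_ne_zero hC0 (mul_ne_zero (Complex.exp_ne_zero _)
      (mul_ne_zero ?_ (neg_ne_zero.2 (div_ne_zero (mul_ne_zero ?_ ?_) (D.J_ne_zero hv.1))))))
    -- The factor `c + Λ'` cannot vanish, because `c ≥ 1` and `|Λ'| ≤ 1 / 2`.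
    · intro h
      have h3 : (c : ℂ) = -deriv Λ (σ v) := by linear_combination h
      have h4 := congrArg norm h3
      rw [norm_neg, Complex.norm_real, Real.norm_of_nonneg (by linarith)] at h4
      linarith [(hY' _ hYσ).2]
    · exact_mod_cast (half_pos D.ρ_pos).ne'
    -- Critical points of `J` satisfy `v ^ 2 = 1`, excluded by `|v| > 1`.
    · intro h
      have h3 : (v ^ 2)⁻¹ = 1 := by linear_combination -h
      have h4 : v ^ 2 = 1 := inv_eq_one.1 h3
      have h5 := congrArg norm h4
      rw [norm_pow, norm_one] at h5
      nlinarith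
  · intro v' hv' hG'
    obtain ⟨h1, h2⟩ := hA v hv hG
    obtain ⟨h1', h2'⟩ := hA v' hv' hG'
    have h3 : σ v = σ v' := hinj (hσre v hv.1 h2) (hσre v' hv'.1 h2')
      ((hM v hv hG).trans (hM v' hv' hG').symm)
    have h4 : D.J v = D.J v' := by
      rw [← Complex.exp_log (D.J_ne_zero hv.1), ← Complex.exp_log (D.J_ne_zero hv'.1),
        neg_inj.1 h3]
    exact D.injOn_J hv.1 hv'.1 h4

end PowerData

/-! ### The inverse near infinity and membership in UI. -/

theorem norm_le_of_mul_abs_re_lt_im {γ : ℝ} (hγ : 0 < γ) {z : ℂ} (hz : γ * |z.re| < z.im) :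
    ‖z‖ ≤ (1 / γ + 1) * z.im := by
  have h1 : |z.re| ≤ 1 / γ * z.im := by
    rw [one_div, inv_mul_eq_div, le_div_iff₀ hγ]; linarith
  have h2 : 0 < z.im := lt_of_le_of_lt (by positivity) hz
  have h3 := Complex.norm_le_abs_re_add_abs_im z
  rw [abs_of_pos h2] at h3
  linarith

namespace PowerData

variable {N : ℕ} (D : PowerData N)

theorem hasStrictDerivAt_mul_Φ : HasStrictDerivAt (fun u => u * D.Φ u) 1 0 := by
  have h1 : AnalyticAt ℂ (fun u => u * D.Φ u) 0 := analyticAt_id.mul D.analyticAt_Φ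
  have h2 := ((hasDerivAt_id (0 : ℂ)).mul D.analyticAt_Φ.differentiableAt.hasDerivAt).deriv
  have h3 : deriv (fun u => u * D.Φ u) 0 = 1 := by
    simpa [D.Φ_zero] using! h2
  simpa [h3] using h1.hasStrictDerivAt

/-- In the coordinate `u = 1 / z` the Cauchy transform is `u * Φ u`, with derivative `1` at `0`, so
its local inverse is tangent to the identity and distorts cones only slightly. -/
theorem exists_cone {γ : ℝ} (hγ : 0 < γ) : ∃ lam M δ : ℝ, 0 < lam ∧ 0 < M ∧ 0 < δ ∧
    InjOn D.G (truncatedCone lam M) ∧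
    ∀ w ∈ triangularDomain γ δ, ∃ z ∈ truncatedCone lam M, D.G z = w := by
  have hs := D.hasStrictDerivAt_mul_Φ
  set F : ℂ → ℂ := fun u => u * D.Φ u with hF
  have hF0 : F 0 = 0 := by simp [hF]
  set k := hs.localInverse _ _ _ one_ne_zero
  have hk0 : k 0 = 0 := by
    have : k (F 0) = 0 := HasStrictFDerivAt.localInverse_apply_image ..
    rwa [hF0] at this
  have hkl : ∀ᶠ u in 𝓝 (0 : ℂ), k (F u) = u := hs.eventually_left_inverse one_ne_zero
  have hkr : ∀ᶠ w in 𝓝 (0 : ℂ), F (k w) = w := by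
    have := hs.eventually_right_inverse one_ne_zero
    rwa [hF0] at this
  have hkd : HasDerivAt k 1 0 := by
    have := (hs.to_localInverse one_ne_zero).hasDerivAt
    rw [hF0, inv_one] at this
    exact this
  obtain ⟨ε, hε, hεk⟩ := Metric.eventually_nhds_iff.1 hkl
  set K : ℝ := 1 / γ + 1 with hK
  have hK0 : 0 < K := by positivity
  set η : ℝ := 1 / (4 * K * (1 + γ)) with hη
  -- `η` is a relative error small enough to open the cone only from parameter `γ` to `γ / 2`; `K`
  -- bounds `‖w‖ / |w.im|` on the triangular domain.
  have hη0 : 0 < η := by positivity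
  have hratio : ∀ᶠ w in 𝓝[≠] (0 : ℂ), ‖w / k w - 1‖ < η := by
    have h1 : Tendsto (fun w => (w⁻¹ * k w)⁻¹) (𝓝[≠] 0) (𝓝 1) := by
      have h2 := hkd.tendsto_slope_zero
      simp only [zero_add, hk0, sub_zero, smul_eq_mul] at h2
      simpa using h2.inv₀ one_ne_zero
    filter_upwards [h1 (ball_mem_nhds 1 hη0)] with w hw
    have : (w⁻¹ * k w)⁻¹ = w / k w := by rw [mul_inv, inv_inv, div_eq_mul_inv]
    rwa [mem_preimage, this, mem_ball, dist_eq_norm] at hw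
  rw [eventually_nhdsWithin_iff] at hratio
  obtain ⟨ε', hε', hεk'⟩ := Metric.eventually_nhds_iff.1 (hkr.and hratio)
  set M : ℝ := 1 / ε with hM
  have hM0 : 0 < M := by positivity
  set δ : ℝ := min ε' (1 / (2 * K * M)) / K with hδ
  have hδ0 : 0 < δ := div_pos (lt_min hε' (by positivity)) hK0
  refine ⟨γ / 2, M, δ, by positivity, hM0, hδ0, ?_, ?_⟩
  · have hG : ∀ z ∈ truncatedCone (γ / 2) M, k (D.G z) = z⁻¹ := by
      rintro z ⟨h1, -, h3⟩
      have hz : z ≠ 0 := by rintro rfl; simp at h1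
      have h4 : M < ‖z‖ :=
        h3.trans_le ((le_abs_self _).trans (Complex.abs_im_le_norm z))
      rw [D.G_eq_Φ hz]
      refine hεk (y := z⁻¹) ?_
      rw [dist_zero_right, norm_inv]
      rw [hM, one_div] at h4
      exact inv_lt_of_inv_lt₀ hε h4
    intro z hz z' hz' h
    rw [← inv_inj, ← hG z hz, ← hG z' hz', h]
  · rintro w ⟨h1, h2, h3⟩
    have hw0 : w ≠ 0 := by rintro rfl; simp at h1
    have hwn : ‖w‖ < min ε' (1 / (2 * K * M)) := by
      have h4 := norm_le_of_mul_abs_re_lt_im hγ (z := -w) (by simpa using h2)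
      rw [norm_neg, Complex.neg_im] at h4
      have h5 : K * -w.im < K * δ := mul_lt_mul_of_pos_left (by linarith) hK0
      have h6 : K * δ = min ε' (1 / (2 * K * M)) := by rw [hδ]; field_simp
      linarith
    obtain ⟨h4, h5⟩ := hεk' (y := w) (by
      rw [dist_zero_right]; exact hwn.trans_le (min_le_left _ _))
    have h5 := h5 hw0
    have hkw : k w ≠ 0 := by
      intro h
      rw [h, hF0] at h4
      exact hw0 h4.symm
    refine ⟨(k w)⁻¹, ?_, ?_⟩
    · set p := w⁻¹ with hp
      set z := (k w)⁻¹ with hz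
      have hnw : 0 < Complex.normSq w := Complex.normSq_pos.2 hw0
      have hpim : p.im = -w.im / Complex.normSq w := Complex.inv_im w
      have hpre : p.re = w.re / Complex.normSq w := Complex.inv_re w
      have hp1 : γ * |p.re| < p.im := by
        rw [hpre, hpim, abs_div, abs_of_pos hnw, ← mul_div_assoc]
        exact div_lt_div_of_pos_right h2 hnw
      have hpn := norm_le_of_mul_abs_re_lt_im hγ hp1
      rw [← hK] at hpn
      have hp0 : 0 < p.im := by rw [hpim]; exact div_pos (by linarith) hnw
      have hzp : ‖z - p‖ ≤ p.im / (4 * (1 + γ)) := by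
        have e : z - p = p * (w / k w - 1) := by
          rw [hz, hp]; field_simp
        rw [e, norm_mul]
        calc ‖p‖ * ‖w / k w - 1‖ ≤ (K * p.im) * η :=
              mul_le_mul hpn h5.le (norm_nonneg _) (by positivity)
          _ = p.im / (4 * (1 + γ)) := by rw [hη]; field_simp
      have hre := (Complex.abs_re_le_norm (z - p)).trans hzp
      have him := (abs_le.1 ((Complex.abs_im_le_norm (z - p)).trans hzp)).1
      rw [Complex.sub_im] at him
      rw [Complex.sub_re] at hre
      have hg4 : p.im / (4 * (1 + γ)) * (1 + γ) = p.im / 4 := by field_simp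
      set e := p.im / (4 * (1 + γ)) with he
      have he0 : 0 < e := by positivity
      have hzim : 3 / 4 * p.im ≤ z.im := by nlinarith
      have hzre : |z.re| ≤ |p.re| + e := by
        have : z.re = p.re + (z.re - p.re) := by ring
        rw [this]
        exact (abs_add_le _ _).trans (by linarith)
      have hpM : 2 * M < p.im := by
        have h6 : ‖w‖ < 1 / (2 * K * M) := hwn.trans_le (min_le_right _ _)
        have h7 : 2 * K * M < ‖p‖ := by
          rw [hp, norm_inv]
          rw [one_div] at h6
          exact lt_inv_of_lt_inv₀ (norm_pos_iff.2 hw0) h6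
        have h8 : K * (2 * M) < K * p.im := by linarith
        exact lt_of_mul_lt_mul_left h8 hK0.le
      refine ⟨by linarith, ?_, by linarith⟩
      nlinarith
    · rw [D.G_eq_Φ (inv_ne_zero hkw), inv_inv]
      exact h4

theorem exists_J_eq {z : ℂ} (hz : 0 < z.im) : ∃ v : ℂ, v.im < 0 ∧ ‖v‖ < 1 ∧ D.J v = z := by
  have hρ : (D.ρ : ℂ) ≠ 0 := by exact_mod_cast D.ρ_pos.ne'
  obtain ⟨v, hv⟩ : ∃ v : ℂ, D.J v = z := by
    set t : ℂ := (z - ((D.a + D.b) / 2 : ℝ)) / D.ρ with ht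
    obtain ⟨s, hs⟩ := IsAlgClosed.exists_pow_nat_eq (t ^ 2 - 1) (n := 2) (by norm_num)
    have h1 : (t + s) * (t - s) = 1 := by linear_combination -hs
    refine ⟨t + s, ?_⟩
    rw [J_eq, ← eq_inv_of_mul_eq_one_right h1, ht]
    field_simp
    ring
  have key : ∀ v : ℂ, D.J v = z → ‖v‖ < 1 → v.im < 0 := by
    intro v hv h1
    have h0 : 0 < D.ρ * v.im * (1 - (Complex.normSq v)⁻¹) / 2 := by rw [← J_im, hv]; exact hz
    have hv0 : v ≠ 0 := by rintro rfl; simp at h0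
    have h2 : 0 < Complex.normSq v := Complex.normSq_pos.2 hv0
    have h3 : Complex.normSq v < 1 := by
      rw [Complex.normSq_eq_norm_sq]; nlinarith [norm_nonneg v]
    have h4 : 1 < (Complex.normSq v)⁻¹ := one_lt_inv_iff₀.2 ⟨h2, h3⟩
    by_contra! h5
    nlinarith [mul_nonneg D.ρ_pos.le h5]
  rcases lt_trichotomy ‖v‖ 1 with h1 | h1 | h1
  · exact ⟨v, key v hv h1, h1, hv⟩
  · obtain ⟨x, -, hx⟩ := D.J_mem_Icc h1
    rw [← hv, hx, Complex.ofReal_im] at hz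
    exact absurd hz (lt_irrefl _)
  · have h2 : ‖v⁻¹‖ < 1 := by rw [norm_inv]; exact inv_lt_one_of_one_lt₀ h1
    have h3 : D.J v⁻¹ = z := by rw [J_inv, hv]
    exact ⟨v⁻¹, key _ h3 h2, h2, h3⟩

/-- The principal `r`-th root of `z` lies in the upper half of the sector, hence comes from the unit
disc, where `Gt` is the original Cauchy transform. -/
theorem exists_mem_V {z : ℂ} (hz : 0 < z.im) :
    ∃ v ∈ D.V, D.J v ^ (D.r : ℂ) = z ∧ D.Gt v = D.G z := by
  have hr := D.r_pos
  have hz0 : z ≠ 0 := by rintro rfl; simp at hz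
  set ζ : ℂ := Complex.exp (((D.r⁻¹ : ℝ) : ℂ) * Complex.log z) with hζ
  have him : (((D.r⁻¹ : ℝ) : ℂ) * Complex.log z).im = z.arg / D.r := by
    rw [Complex.im_ofReal_mul, Complex.log_im]; ring
  have harg0 : 0 < z.arg := by
    refine lt_of_le_of_ne (Complex.arg_nonneg_iff.2 hz.le) fun h => ?_
    exact hz.ne' (Complex.arg_eq_zero_iff.1 h.symm).2
  have hargπ : z.arg < π := by
    refine lt_of_le_of_ne (Complex.arg_le_pi z) fun h => ?_
    exact hz.ne' (Complex.arg_eq_pi_iff.1 h).2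
  have h1 : 0 < z.arg / D.r := div_pos harg0 hr
  have h2 : z.arg / D.r < π := (div_le_self harg0.le D.hr).trans_lt hargπ
  have hlog : Complex.log ζ = ((D.r⁻¹ : ℝ) : ℂ) * Complex.log z := by
    rw [hζ, Complex.log_exp]
    · rw [him]; linarith
    · rw [him]; exact h2.le
  have hζim : 0 < ζ.im := by
    rw [hζ, Complex.exp_im, him]
    exact mul_pos (Real.exp_pos _) (Real.sin_pos_of_pos_of_lt_pi h1 h2)
  obtain ⟨v, hv, hv1, hJ⟩ := D.exists_J_eq hζim
  have hζarg : ζ.arg = z.arg / D.r := by rw [← Complex.log_im, hlog, him]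
  have hV : v ∈ D.V := by
    refine ⟨hv, ?_⟩
    rw [hJ, hζarg, abs_of_pos h1, mul_div_cancel₀ _ hr.ne']
    exact hargπ
  have hpow : D.J v ^ (D.r : ℂ) = z := by
    rw [hJ, Complex.cpow_def_of_ne_zero (Complex.exp_ne_zero _), hlog]
    have := D.r_ne
    rw [show ((D.r⁻¹ : ℝ) : ℂ) * Complex.log z * D.r = Complex.log z by
      push_cast; field_simp, Complex.exp_log hz0]
  exact ⟨v, hV, hpow, by rw [D.Gt_of_norm_lt hV hv1, hpow]⟩

/-- In the exceptional boundary case `J v ^ (l k + r) * Gt v` tends to a nonzero constant, whereas a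
finite limit of `Gt` would force it to `0`. -/
theorem properOver_Gt : ProperOver D.Gt D.V lowerHalfPlane := by
  intro u hu w hw ht
  rcases D.boundary_behaviour u hu with h | ⟨w', hw', ht'⟩ | ⟨h1, h2⟩
  · exact h
  · have hw2 : w.im < 0 := hw
    rw [tendsto_nhds_unique ht ht'] at hw2
    exact absurd hw2 (not_lt.2 hw')
  · exfalso
    obtain ⟨k, hk⟩ := D.exists_max_l
    have hc : 0 < D.l k + D.r := by linarith [D.hl0 k, D.r_pos]
    have huV : ∀ᶠ v in (u : Filter ℂ), v ∈ D.V := hu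
    have hσ : Tendsto (fun v => -Complex.log (D.J v)) u (comap Complex.re atTop) := by
      rw [tendsto_comap_iff]
      have h3 : Tendsto (fun v => ‖D.J v‖) u (𝓝[>] 0) := by
        refine tendsto_nhdsWithin_iff.2 ⟨by simpa using h2.norm, ?_⟩
        filter_upwards [huV] with v hv using norm_pos_iff.2 (D.J_ne_zero hv.1)
      refine (tendsto_neg_atBot_atTop.comp (Real.tendsto_log_nhdsGT_zero.comp h3)).congr
        fun v => ?_
      simp [Complex.log_re]
    have h4 := (tendsto_exp_neg_mul_comap_re hc).comp hσ
    have h5 : Tendsto (fun v => Complex.exp (-((D.l k + D.r : ℝ) : ℂ) * -Complex.log (D.J v)) *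
        D.Gt v) u (𝓝 (0 * w)) := h4.mul ht
    have h6 : Tendsto (fun v => -D.Ψ k (-Complex.log (D.J v))) u
        (𝓝 (-(D.leadCoeff k : ℂ))) := ((D.tendsto_Ψ hk).comp hσ).neg
    have h7 : ∀ᶠ v in (u : Filter ℂ), ‖D.J v‖ < D.a / 4 := by
      have := h2.norm
      rw [norm_zero] at this
      exact this.eventually (gt_mem_nhds (by linarith [D.ha]))
    have h8 : (fun v => Complex.exp (-((D.l k + D.r : ℝ) : ℂ) * -Complex.log (D.J v)) * D.Gt v)
        =ᶠ[u] fun v => -D.Ψ k (-Complex.log (D.J v)) := by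
      filter_upwards [huV, h1, h7] with v hv hv1 hv2
      rw [D.Gt_eq_exp_mul_Ψ k hv hv1 hv2, mul_neg, ← mul_assoc, ← Complex.exp_add, neg_mul,
        neg_add_cancel, Complex.exp_zero, one_mul]
    have h9 := tendsto_nhds_unique (h5.congr' h8) h6
    have h10 := D.leadCoeff_pos k
    rw [zero_mul, zero_eq_neg, Complex.ofReal_eq_zero] at h9
    exact h10.ne' h9

theorem isUI {μ : Measure ℝ} (hμ : IsProbabilityMeasure μ)
    (hG : ∀ z : ℂ, 0 < z.im → cauchyTransform μ z = D.G z) : IsUI μ := by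
  have hne : ∃ v ∈ D.V, D.Gt v ∈ lowerHalfPlane := by
    obtain ⟨lam, M, δ, -, -, hδ, -, h⟩ := D.exists_cone one_pos
    obtain ⟨z, hz, hzw⟩ := h (-((δ / 2 : ℝ) : ℂ) * Complex.I)
      ⟨by simpa using hδ, by simpa using hδ, by simpa using hδ⟩
    obtain ⟨v, hv, -, hGv⟩ := D.exists_mem_V hz.1
    refine ⟨v, hv, ?_⟩
    rw [hGv, hzw]
    simpa [lowerHalfPlane] using hδ
  obtain ⟨h, hd, hh⟩ := D.properOver_Gt.exists_inverse D.isOpen_V D.differentiableOn_Gt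
    isOpen_lowerHalfPlane isPreconnected_lowerHalfPlane hne D.exists_unique_noncritical_value
  refine ⟨hμ, fun w => D.J (h w) ^ (D.r : ℂ), ?_, ?_, ?_⟩
  · intro w hw
    have hv := (hh w hw).1
    have h1 : DifferentiableAt ℂ (fun z : ℂ => z ^ (D.r : ℂ)) (D.J (h w)) :=
      differentiableAt_id.cpow (differentiableAt_const _) (D.J_mem_sector hv).1
    have h2 : DifferentiableAt ℂ h w := hd.differentiableAt (isOpen_lowerHalfPlane.mem_nhds hw)
    exact (h1.comp w ((D.differentiableAt_J (ne_zero_of_im_neg hv.1)).comp w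
      h2)).differentiableWithinAt
  · intro w hw w' hw' e
    have h1 := D.injOn_cpow (D.J_mem_sector (hh w hw).1) (D.J_mem_sector (hh w' hw').1) e
    have h2 := D.injOn_J (hh w hw).1.1 (hh w' hw').1.1 h1
    rw [← (hh w hw).2.1, h2, (hh w' hw').2.1]
  · intro γ hγ
    obtain ⟨lam, M, δ, hlam, hM, hδ, hinj, hex⟩ := D.exists_cone hγ
    refine ⟨lam, M, δ, hlam, hM, hδ, ?_, fun w hw => ?_⟩
    · intro z hz z' hz' e
      rw [hG z hz.1, hG z' hz'.1] at e
      exact hinj hz hz' e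
    · obtain ⟨z, hz, hzw⟩ := hex w hw
      obtain ⟨v, hv, hJz, hGv⟩ := D.exists_mem_V hz.1
      -- Uniqueness of preimages in `V` identifies the global inverse with the local one in the
      -- cone.
      have hvw : v = h w := (hh w hw.1).2.2 v hv (hGv.trans hzw)
      have e : D.J (h w) ^ (D.r : ℂ) = z := by rw [← hvw, hJz]
      simp only [e]
      exact ⟨hz, by rw [hG z hz.1, hzw]⟩

end PowerData

/-! ### Integrals against the law and the inversion `x = 1 / u`. -/

section Law

variable {a b : ℝ} {N : ℕ} {α l : Fin N → ℝ}

theorem gpfpDensity_eq_indicator (ha : 0 < a) : gpfpDensity a b N α l =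
    indicator (Ioo a b) fun x => √((b - x) * (x - a)) * ∑ k, α k * x ^ (-1 - l k) := by
  unfold gpfpDensity
  refine indicator_congr fun x hx => ?_
  have hx0 : 0 < x := ha.trans hx.1
  rw [div_mul_eq_mul_div, mul_div_assoc, Finset.sum_div]
  congr 1
  refine Finset.sum_congr rfl fun k _ => ?_
  rw [Real.rpow_sub hx0, Real.rpow_neg_one]
  field_simp

theorem integral_comp_of_hasLaw_gpfp {Ω : Type*} [MeasurableSpace Ω] {P : Measure Ω}
    (ha : 0 < a) (hab : a < b) (hα : ∀ k, 0 < α k) {X : Ω → ℝ}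
    (hX : HasLaw X (gpfp a b N α l) P) {g : ℝ → ℂ} (hg : Measurable g) :
    ∫ ω, g (X ω) ∂P = ∫ x in a..b,
      ((√((b - x) * (x - a)) * ∑ k, α k * x ^ (-1 - l k) : ℝ) : ℂ) * g x := by
  have hmeas : Measurable (gpfpDensity a b N α l) := by
    unfold gpfpDensity
    refine Measurable.indicator ?_ measurableSet_Ioo
    fun_prop
  have h1 : ∫ ω, g (X ω) ∂P = ∫ x, g x ∂(gpfp a b N α l) := by
    rw [← hX.map_eq, integral_map hX.aemeasurable hg.aestronglyMeasurable]
  have h2 : ∀ x, 0 ≤ gpfpDensity a b N α l x := by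
    intro x
    unfold gpfpDensity
    refine indicator_nonneg (fun x hx => ?_) x
    have hx0 : 0 < x := ha.trans hx.1
    refine mul_nonneg (div_nonneg (Real.sqrt_nonneg _) hx0.le) (Finset.sum_nonneg fun k _ => ?_)
    exact div_nonneg (hα k).le (Real.rpow_nonneg hx0.le _)
  rw [h1, gpfp, integral_withDensity_eq_integral_toReal_smul hmeas.ennreal_ofReal
    (Eventually.of_forall fun _ => ENNReal.ofReal_lt_top),
    intervalIntegral.integral_of_le hab.le, integral_Ioc_eq_integral_Ioo,
    ← integral_indicator measurableSet_Ioo]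
  congr 1
  ext x
  rw [ENNReal.toReal_ofReal (h2 x), gpfpDensity_eq_indicator ha]
  by_cases hx : x ∈ Ioo a b
  · rw [indicator_of_mem hx, indicator_of_mem hx, Complex.real_smul]
  · rw [indicator_of_notMem hx, indicator_of_notMem hx, zero_smul]

/-- The substitution `x = 1 / u` preserves the family of densities. -/
theorem integral_inv_substitution (ha : 0 < a) (hab : a < b) {g : ℝ → ℂ}
    (hg : ContinuousOn g (Icc a b)) :
    ∫ x in a..b, ((√((b - x) * (x - a)) * ∑ k, α k * x ^ (-1 - l k) : ℝ) : ℂ) * g x =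
    ∫ u in b⁻¹..a⁻¹, ((√((a⁻¹ - u) * (u - b⁻¹)) *
      ∑ k, √(a * b) * α k * u ^ (-1 - (1 - l k)) : ℝ) : ℂ) * g u⁻¹ := by
  have hb : 0 < b := ha.trans hab
  have hinv : b⁻¹ ≤ a⁻¹ := inv_anti₀ ha hab.le
  set f : ℝ → ℂ := fun x =>
    ((√((b - x) * (x - a)) * ∑ k, α k * x ^ (-1 - l k) : ℝ) : ℂ) * g x with hf
  have hpos : ∀ u ∈ uIcc b⁻¹ a⁻¹, 0 < u := by
    intro u hu
    rw [uIcc_of_le hinv] at hu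
    exact (inv_pos.2 hb).trans_le hu.1
  have himage : (fun u : ℝ => u⁻¹) '' uIcc b⁻¹ a⁻¹ ⊆ Icc a b := by
    rintro _ ⟨u, hu, rfl⟩
    have hu0 := hpos u hu
    rw [uIcc_of_le hinv] at hu
    exact ⟨(le_inv_comm₀ ha hu0).2 hu.2, (inv_le_comm₀ hb hu0).1 hu.1⟩
  have hfc : ContinuousOn f (Icc a b) := by
    refine ContinuousOn.mul (Complex.continuous_ofReal.comp_continuousOn ?_) hg
    refine ContinuousOn.mul (by fun_prop) (continuousOn_finsetSum _ fun k _ => ?_)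
    refine ContinuousOn.mul continuousOn_const fun x hx => ?_
    exact (Real.continuousAt_rpow_const _ _
      (Or.inl (ha.trans_le hx.1).ne')).continuousWithinAt
  have key := intervalIntegral.integral_deriv_smul_comp' (a := b⁻¹) (b := a⁻¹)
    (f := fun u : ℝ => u⁻¹) (f' := fun u => -(u ^ 2)⁻¹) (g := f)
    (fun u hu => hasDerivAt_inv (hpos u hu).ne')
    (ContinuousOn.neg (ContinuousOn.inv₀ (by fun_prop) fun u hu =>
      pow_ne_zero _ (hpos u hu).ne')) (hfc.mono himage)
  rw [inv_inv, inv_inv, intervalIntegral.integral_symm a b] at key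
  rw [← neg_inj, ← key, ← intervalIntegral.integral_neg]
  refine intervalIntegral.integral_congr fun u hu => ?_
  have hu0 := hpos u hu
  rw [uIcc_of_le hinv] at hu
  have hs : √((b - u⁻¹) * (u⁻¹ - a)) = √(a * b) * √((a⁻¹ - u) * (u - b⁻¹)) * u⁻¹ := by
    rw [← Real.sqrt_mul (mul_pos ha hb).le, ← Real.sqrt_sq (inv_pos.2 hu0).le, ← Real.sqrt_mul]
    · congr 1
      rw [Real.sqrt_sq (inv_pos.2 hu0).le]
      field_simp
    · exact mul_nonneg (mul_pos ha hb).le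
        (mul_nonneg (sub_nonneg.2 hu.2) (sub_nonneg.2 hu.1))
  have hp : ∀ k, (u ^ 2)⁻¹ * u⁻¹ * u⁻¹ ^ (-1 - l k) = u ^ (-1 - (1 - l k)) := by
    intro k
    rw [Real.inv_rpow hu0.le, ← Real.rpow_neg hu0.le, ← Real.rpow_natCast, ← Real.rpow_neg hu0.le,
      ← Real.rpow_neg_one u, ← Real.rpow_add hu0, ← Real.rpow_add hu0]
    congr 1
    push_cast; ring
  have hfu : (u ^ 2)⁻¹ * (√((b - u⁻¹) * (u⁻¹ - a)) * ∑ k, α k * u⁻¹ ^ (-1 - l k)) =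
      √((a⁻¹ - u) * (u - b⁻¹)) * ∑ k, √(a * b) * α k * u ^ (-1 - (1 - l k)) := by
    rw [hs, Finset.mul_sum, Finset.mul_sum, Finset.mul_sum]
    refine Finset.sum_congr rfl fun k _ => ?_
    rw [← hp k]; ring
  simp only [Function.comp, hf, Complex.real_smul]
  rw [← hfu]
  push_cast; ring

theorem measurable_one_div_sub_rpow (z : ℂ) (r : ℝ) :
    Measurable fun x : ℝ => 1 / (z - ((x ^ r : ℝ) : ℂ)) := by
  fun_prop

theorem cauchyTransform_map_rpow {Ω : Type*} [MeasurableSpace Ω] {P : Measure Ω} {X : Ω → ℝ}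
    (hX : AEMeasurable X P) (r : ℝ) (z : ℂ) :
    cauchyTransform (P.map fun ω => X ω ^ r) z = ∫ ω, 1 / (z - ((X ω ^ r : ℝ) : ℂ)) ∂P := by
  rw [cauchyTransform, integral_map (by fun_prop)]
  have : Measurable fun x : ℝ => 1 / (z - (x : ℂ)) := by fun_prop
  exact this.aestronglyMeasurable

end Law

/-- All powers of exponent at least `1` in absolute value of a random variable with law
`gpfp a b N α l` have law in the class UI. -/
theorem isUI_map_rpow_of_hasLaw_gpfp {Ω : Type*} [MeasurableSpace Ω] (P : Measure Ω) [IsProbabilityMeasure P]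
    (a b : ℝ) (ha : 0 < a) (hab : a < b) (N : ℕ) (α l : Fin N → ℝ)
    (hα : ∀ k, 0 < α k) (hl : StrictMono l) (hl01 : ∀ k, l k ∈ Set.Icc (0 : ℝ) 1)
    (X : Ω → ℝ) (hX : HasLaw X (gpfp a b N α l) P) :
    ∀ r : ℝ, 1 ≤ |r| → IsUI (P.map (fun ω => X ω ^ r)) := by
  intro r hr
  have hXm := hX.aemeasurable
  have hprob : IsProbabilityMeasure (P.map fun ω => X ω ^ r) :=
    Measure.isProbabilityMeasure_map (by fun_prop)
  have hmass : ∫ x in a..b,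
      ((√((b - x) * (x - a)) * ∑ k, α k * x ^ (-1 - l k) : ℝ) : ℂ) * 1 = 1 := by
    rw [← integral_comp_of_hasLaw_gpfp ha hab hα hX (g := fun _ => 1) measurable_const]
    simp
  have hG : ∀ z : ℂ, cauchyTransform (P.map fun ω => X ω ^ r) z = ∫ x in a..b,
      ((√((b - x) * (x - a)) * ∑ k, α k * x ^ (-1 - l k) : ℝ) : ℂ) *
        (1 / (z - ((x ^ r : ℝ) : ℂ))) := by
    intro z
    rw [cauchyTransform_map_rpow hXm, ← integral_comp_of_hasLaw_gpfp ha hab hα hX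
      (measurable_one_div_sub_rpow z r)]
  rcases le_abs'.1 hr with h | h
  · have hmass' := hmass
    rw [integral_inv_substitution ha hab continuousOn_const] at hmass'
    -- Here `X ^ r = (X⁻¹) ^ (-r)`. Since `l ↦ 1 - l` reverses order, only injectivity of the
    -- exponents is kept.
    let D : PowerData N :=
      { a := b⁻¹
        b := a⁻¹
        r := -r
        α := fun k => √(a * b) * α k
        l := fun k => 1 - l k
        ha := inv_pos.2 (ha.trans hab)
        hab := inv_strictAnti₀ ha hab
        hr := by linarith
        hα := fun k => mul_pos (Real.sqrt_pos.2 (mul_pos ha (ha.trans hab))) (hα k)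
        hl := fun i j e => hl.injective (by simpa using e)
        hl0 := fun k => by linarith [(hl01 k).2]
        hl1 := fun k => by linarith [(hl01 k).1]
        mass := by
          simp_rw [mul_one] at hmass'
          rw [intervalIntegral.integral_ofReal] at hmass'
          exact_mod_cast hmass' }
    refine D.isUI hprob fun z hz => ?_
    have hc : ContinuousOn (fun x : ℝ => 1 / (z - ((x ^ r : ℝ) : ℂ))) (Icc a b) := by
      refine ContinuousOn.div continuousOn_const (continuousOn_const.sub
        (Complex.continuous_ofReal.comp_continuousOn fun x hx =>
          (Real.continuousAt_rpow_const _ _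
            (Or.inl (ha.trans_le hx.1).ne')).continuousWithinAt)) fun x _ h0 => ?_
      rw [sub_eq_zero.1 h0, Complex.ofReal_im] at hz
      exact lt_irrefl _ hz
    rw [hG, integral_inv_substitution ha hab hc]
    refine intervalIntegral.integral_congr fun u hu => ?_
    rw [uIcc_of_le (inv_anti₀ ha hab.le)] at hu
    have hu0 : 0 < u := (inv_pos.2 (ha.trans hab)).trans_le hu.1
    have e : u⁻¹ ^ r = u ^ (-r) := by rw [Real.inv_rpow hu0.le, Real.rpow_neg hu0.le]
    simp only [e, mul_one_div]
    rfl
  · let D : PowerData N :=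
      { a := a
        b := b
        r := r
        α := α
        l := l
        ha := ha
        hab := hab
        hr := h
        hα := hα
        hl := hl.injective
        hl0 := fun k => (hl01 k).1
        hl1 := fun k => (hl01 k).2
        mass := by
          simp_rw [mul_one] at hmass
          rw [intervalIntegral.integral_ofReal] at hmass
          exact_mod_cast hmass }
    refine D.isUI hprob fun z _ => ?_
    rw [hG]
    refine intervalIntegral.integral_congr fun x _ => ?_
    simp only [mul_one_div]
    rfl

end FreeProb

/-- The density of `gpfp a b N α l` integrates to `1` (and hence `N ≠ 0`) because it is the law of
a random variable on a probability space. -/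
theorem corollary4p2 {Ω : Type*} [MeasurableSpace Ω] (P : Measure Ω) [IsProbabilityMeasure P]
    (a b : ℝ) (ha : 0 < a) (hab : a < b) (N : ℕ) (α l : Fin N → ℝ)
    (hα : ∀ k, 0 < α k) (hl : StrictMono l) (hl01 : ∀ k, l k ∈ Set.Icc (0 : ℝ) 1)
    (X : Ω → ℝ) (hX : HasLaw X (FreeProb.gpfp a b N α l) P) :
    ∀ r : ℝ, 1 ≤ |r| → FreeProb.IsUI (P.map (fun ω => X ω ^ r)) := by
  exact FreeProb.isUI_map_rpow_of_hasLaw_gpfp P a b ha hab N α l hα hl hl01 X hX
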